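/- Let $k\ge 1$ be an integer and $d=4k+1$. There is a constant $C>0$, depending only on $d$, such that the following holds for every odd prime power $q$, every non-trivial additive character $\chi$ of $\mathbb{F}_q$ and every primitive element $g$ of $\mathbb{F}_q$ (i.e. every generator $g$ of the multiplicative group $\mathbb{F}_q^*$). Let $$S_g=\{x\in\mathbb{F}_q^d:\ x_1^2+\cdots+x_d^2=g\}$$ be the sphere of radius $g$, and for $f\colon S_g\to\mathbb{C}$ put $$(f\,d\sigma)^\vee(m)=\frac1{|S_g|}\sum_{x\in S_g}\chi(m\cdot x)f(x)\quad (m\in\mathbb{F}_q^d).$$ For $1\le p,r<\infty$ let $R^*_{S_g}(p\to r)$ be the smallest number $R\ge 0$ such that $$\Big(\sum_{m\in\mathbb{F}_q^d}|(f\,d\sigma)^\vee(m)|^r\Big)^{1/r}\le R\,\Big(\frac1{|S_g|}\sum_{x\in S_g}|f(x)|^p\Big)^{1/p}\quad\text{for all } f\colon S_g\to\mathbb{C}.$$ Then $$R^*_{S_g}\Big(\frac{4d}{3d-2}\to 4\Big)\le C .$$ Moreover $\frac{4d}{3d-2}<\frac{4d-4}{3d-5}$, that is, the exponent $p=\frac{4d}{3d-2}$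 is smaller than the Stein--Tomas exponent $p=\frac{4d-4}{3d-5}$ toward $L^p\to L^4$. -/

import Mathlib

namespace FFExtension

/-- `g` is a primitive element of the finite field `F`: a generator of the multiplicative
group `Fˣ`. -/
def IsPrimitiveElement {F : Type*} [Field F] (g : F) : Prop :=
  ∃ u : Fˣ, (u : F) = g ∧ ∀ v : Fˣ, v ∈ Subgroup.zpowers u

/-- The sphere `S_j = {x ∈ F^d : x₁² + ⋯ + x_d² = j}` of radius `j` centered at the origin. -/
def sphere {F : Type*} [Field F] [Fintype F] [DecidableEq F] (d : ℕ) (j : F) :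
    Finset (Fin d → F) :=
  Finset.univ.filter fun x => ∑ i, x i ^ 2 = j

section

variable {F : Type*} [Field F] {d : ℕ}

/-- `(f dσ)^∨(m) = |V|⁻¹ ∑_{x ∈ V} χ(m ⬝ x) f(x)`, where `dσ` is the normalized surface measure
on `V`. Only the values of `f` on `V` matter. -/
noncomputable def extension (χ : AddChar F ℂ) (V : Finset (Fin d → F))
    (f : (Fin d → F) → ℂ) (m : Fin d → F) : ℂ :=
  (V.card : ℂ)⁻¹ * ∑ x ∈ V, χ (∑ i, m i * x i) * f x

/-- The norm of `L^p(V, dσ)` for the normalized surface measure `dσ` on `V`, `1 ≤ p < ∞`. -/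
noncomputable def surfaceNorm (V : Finset (Fin d → F)) (p : ℝ) (f : (Fin d → F) → ℂ) : ℝ :=
  ((V.card : ℝ)⁻¹ * ∑ x ∈ V, ‖f x‖ ^ p) ^ (1 / p)

/-- The norm of `L^r(F^d, dc)` for the counting measure `dc`, `1 ≤ r < ∞`. -/
noncomputable def countingNorm [Fintype F] (r : ℝ) (h : (Fin d → F) → ℂ) : ℝ :=
  (∑ m, ‖h m‖ ^ r) ^ (1 / r)

/-- The nonnegative constants `C` for which the `L^p → L^r` extension inequality
`‖(f dσ)^∨‖_{L^r(F^d, dc)} ≤ C ‖f‖_{L^p(V, dσ)}` holds for all functions `f` on `V`. -/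
def extensionBounds [Fintype F] (χ : AddChar F ℂ) (V : Finset (Fin d → F)) (p r : ℝ) : Set ℝ :=
  {C | 0 ≤ C ∧ ∀ f : (Fin d → F) → ℂ,
    countingNorm r (extension χ V f) ≤ C * surfaceNorm V p f}

/-- `R*_V(p → r)`: the smallest constant in the `L^p → L^r` extension inequality for `V`. -/
noncomputable def extensionConst [Fintype F] (χ : AddChar F ℂ) (V : Finset (Fin d → F))
    (p r : ℝ) : ℝ :=
  sInf (extensionBounds χ V p r)

/-- A smallest constant exists, so that `extensionConst` is not a junk value. -/
theorem isLeast_extensionConst [Fintype F] (χ : AddChar F ℂ) (V : Finset (Fin d → F))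
    {p r : ℝ} (hp : 1 ≤ p) (hr : 1 ≤ r) :
    IsLeast (extensionBounds χ V p r) (extensionConst χ V p r) := by
  have hp0 : 0 < p := by linarith
  have hr0 : 0 < r := by linarith
  have hcl : IsClosed (extensionBounds χ V p r) := by
    have : extensionBounds χ V p r = Set.Ici 0 ∩ ⋂ f : (Fin d → F) → ℂ,
        {C : ℝ | countingNorm r (extension χ V f) ≤ C * surfaceNorm V p f} := by
      ext C
      simp [extensionBounds]
    rw [this]
    exact isClosed_Ici.inter (isClosed_iInter fun f =>
      isClosed_le continuous_const (continuous_id.mul continuous_const))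
  have hbd : BddBelow (extensionBounds χ V p r) := ⟨0, fun C hC => hC.1⟩
  refine (hcl.isLeast_csInf ?_ hbd)
  set N : ℝ := (Fintype.card (Fin d → F) : ℝ)
  set A : ℝ := (V.card : ℝ) ^ (1 / p) with hA
  have hA0 : 0 ≤ A := by positivity
  refine ⟨N ^ (1 / r) * A, by positivity, fun f => ?_⟩
  have hs0 : 0 ≤ surfaceNorm V p f := by unfold surfaceNorm; positivity
  have hpt : ∀ x ∈ V, ‖f x‖ ≤ A * surfaceNorm V p f := by
    intro x hx
    have hc : (0 : ℝ) < V.card := by exact_mod_cast Finset.card_pos.2 ⟨x, hx⟩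
    rw [hA, surfaceNorm, ← Real.mul_rpow (by positivity) (by positivity),
      mul_inv_cancel_left₀ hc.ne']
    have h1 : ‖f x‖ ^ p ≤ ∑ y ∈ V, ‖f y‖ ^ p :=
      Finset.single_le_sum (f := fun y => ‖f y‖ ^ p) (fun y _ => by positivity) hx
    calc ‖f x‖ = (‖f x‖ ^ p) ^ (1 / p) := by
          rw [one_div, Real.rpow_rpow_inv (norm_nonneg _) hp0.ne']
      _ ≤ _ := Real.rpow_le_rpow (by positivity) h1 (by positivity)
  have hext : ∀ m, ‖extension χ V f m‖ ≤ A * surfaceNorm V p f := by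
    intro m
    rw [extension, norm_mul, norm_inv, Complex.norm_natCast]
    have h2 : ‖∑ x ∈ V, χ (∑ i, m i * x i) * f x‖ ≤ V.card * (A * surfaceNorm V p f) := by
      refine (norm_sum_le _ _).trans ?_
      rw [← nsmul_eq_mul]
      refine Finset.sum_le_card_nsmul _ _ _ fun x hx => ?_
      rw [norm_mul, AddChar.norm_apply, one_mul]
      exact hpt x hx
    rcases V.eq_empty_or_nonempty with h | h
    · subst h
      simpa using mul_nonneg hA0 hs0
    · have hc : (0 : ℝ) < V.card := by exact_mod_cast Finset.card_pos.2 h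
      rw [inv_mul_le_iff₀ hc]
      exact h2
  have h3 : ∑ m, ‖extension χ V f m‖ ^ r ≤ N * (A * surfaceNorm V p f) ^ r := by
    rw [← nsmul_eq_mul]
    exact Finset.sum_le_card_nsmul _ _ _ fun m _ =>
      Real.rpow_le_rpow (norm_nonneg _) (hext m) hr0.le
  calc countingNorm r (extension χ V f) ≤ (N * (A * surfaceNorm V p f) ^ r) ^ (1 / r) :=
        Real.rpow_le_rpow (by positivity) h3 (by positivity)
    _ = N ^ (1 / r) * A * surfaceNorm V p f := by
        rw [Real.mul_rpow (by positivity) (by positivity), one_div,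
          Real.rpow_rpow_inv (by positivity) hr0.ne', mul_assoc]

end

end FFExtension

namespace FFExtension

open Finset Matrix

/-! ### Characters, quadratic Gauss sums and elliptic quadratic forms. -/

section Fourier

set_option linter.unusedSectionVars false

variable {F : Type*} [Field F] [Fintype F] [DecidableEq F] {ι : Type*} [Fintype ι]
  [DecidableEq ι] {ψ : AddChar F ℂ}

/-! Expanding the fourth power turns the `L^4` norm of the extension of an indicator `1_A` into the
additive energy of `A`, so the core is the bound `q E(A) ≤ 3|A|^3 + 5 q^(d/2) |A|^2` for `A` on the
sphere (`card_mul_energy_le`).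

If `a + b = c + e` on a sphere, then `a - c` and `b - c` are orthogonal. For fixed `c`, the
non-isotropic differences `a - c` point in distinct directions, and Parseval applied to the cone
over them bounds the orthogonal pairs. Isotropic differences are counted separately: lift `a` to
`(1, a)`, which is isotropic for `-g x₀² + x₁² + ⋯ + x_d²`. A primitive `g` is a nonsquare and `d +
1 = 4k + 2`, so this form is elliptic. Its Gauss sums then carry a minus sign that makes the large
Fourier weights harmless. The cone over the lift has `q - 1` times as many points as `A`, which
improves the error term by that factor.

The trivial bound `E(A) ≤ |A|^3` wins for `|A|` below about `q^((d-2)/2)`. Summing over dyadic level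
sets of `f` gives minima of a growing and a decaying geometric progression, exactly because `p/2 < 1
< 3p/4`. Such sums are controlled by the crossing point, so the endpoint `p = 4d/(3d-2)` is reached
without a logarithmic loss. -/

theorem addChar_dotProduct (ψ : AddChar F ℂ) (w z : ι → F) :
    ψ (w ⬝ᵥ z) = ∏ i, ψ (w i * z i) := by
  simp only [dotProduct]
  induction (univ : Finset ι) using Finset.induction_on with
  | empty => simp
  | insert a s ha ih => rw [sum_insert ha, prod_insert ha, AddChar.map_add_eq_mul, ih]

theorem sum_addChar_mul (hψ : ψ ≠ 1) (a : F) :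
    ∑ s, ψ (s * a) = if a = 0 then (Fintype.card F : ℂ) else 0 := by
  rw [AddChar.sum_mulShift a (AddChar.IsPrimitive.of_ne_one hψ)]
  split_ifs <;> simp

theorem sum_addChar_dotProduct (hψ : ψ ≠ 1) (z : ι → F) :
    ∑ w, ψ (w ⬝ᵥ z) = if z = 0 then (Fintype.card F : ℂ) ^ Fintype.card ι else 0 := by
  have h : ∑ w : ι → F, ψ (w ⬝ᵥ z) = ∏ i, ∑ s, ψ (s * z i) := by
    rw [prod_univ_sum, Fintype.piFinset_univ]
    exact sum_congr rfl fun w _ => addChar_dotProduct ψ w z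
  rw [h]
  simp only [sum_addChar_mul hψ]
  split_ifs with hz
  · simp [hz]
  · obtain ⟨i, hi⟩ := Function.ne_iff.1 hz
    exact prod_eq_zero (mem_univ i) (by simpa using hi)

theorem norm_sq_sum_addChar (ψ : AddChar F ℂ) (X : Finset (ι → F)) (w : ι → F) :
    ((‖∑ x ∈ X, ψ (w ⬝ᵥ x)‖ ^ 2 : ℝ) : ℂ) = ∑ x ∈ X, ∑ y ∈ X, ψ (w ⬝ᵥ (x - y)) := by
  rw [← Complex.normSq_eq_norm_sq, ← Complex.mul_conj, map_sum, sum_mul_sum]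
  refine sum_congr rfl fun x _ => sum_congr rfl fun y _ => ?_
  rw [← AddChar.map_neg_eq_conj, ← AddChar.map_add_eq_mul, dotProduct_sub, sub_eq_add_neg]

/-- Parseval's identity for the indicator function of a set. -/
theorem sum_norm_sq_sum_addChar (hψ : ψ ≠ 1) (X : Finset (ι → F)) :
    ∑ w, ‖∑ x ∈ X, ψ (w ⬝ᵥ x)‖ ^ 2 = (Fintype.card F : ℝ) ^ Fintype.card ι * #X := by
  rw [← Complex.ofReal_inj, Complex.ofReal_sum]
  simp only [norm_sq_sum_addChar]
  rw [sum_comm]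
  have : ∀ x ∈ X, ∑ w, ∑ y ∈ X, ψ (w ⬝ᵥ (x - y)) = (Fintype.card F : ℂ) ^ Fintype.card ι := by
    intro x hx
    rw [sum_comm]
    simp only [sum_addChar_dotProduct hψ, sub_eq_zero]
    simp [hx]
  rw [sum_congr rfl this]
  simp [mul_comm]

/-- The quadratic Gauss sum. -/
noncomputable def quadSum (ψ : AddChar F ℂ) : ℂ := ∑ x, ψ (x ^ 2)

/-- Each `y` has `1 + η(y)` square roots, `η` the quadratic character, and the constant `1`
contributes a vanishing character sum. -/
theorem sum_addChar_mul_sq (hF : ringChar F ≠ 2) (hψ : ψ ≠ 1) {a : F} (ha : a ≠ 0) :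
    ∑ x, ψ (a * x ^ 2) =
      gaussSum ((quadraticChar F).ringHomComp (Int.castRingHom ℂ)) (ψ.mulShift a) := by
  have h1 : ∑ x, ψ (a * x ^ 2) = ∑ y, ((quadraticChar F y + 1 : ℤ) : ℂ) * ψ (a * y) := by
    rw [← sum_fiberwise_of_maps_to (t := univ) (g := fun x : F => x ^ 2) (fun _ _ => mem_univ _)]
    refine sum_congr rfl fun y _ => ?_
    rw [← quadraticChar_card_sqrts hF y]
    rw [sum_congr rfl (g := fun _ => ψ (a * y)) fun x hx => by rw [(mem_filter.1 hx).2]]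
    have h : ({x | x ^ 2 = y} : Finset F) = {x : F | x ^ 2 = y}.toFinset := by ext x; simp
    rw [sum_const, nsmul_eq_mul, h, Int.cast_natCast]
  rw [h1, gaussSum]
  simp only [Int.cast_add, Int.cast_one, add_mul, one_mul, sum_add_distrib]
  have h2 : ∑ y, ψ (a * y) = 0 := by
    have := sum_addChar_mul hψ a
    simp only [ha, if_false] at this
    simpa only [mul_comm] using this
  rw [h2, add_zero]
  simp [AddChar.mulShift_apply]

theorem sum_addChar_mul_sq' (hF : ringChar F ≠ 2) (hψ : ψ ≠ 1) {a : F} (ha : a ≠ 0) :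
    ∑ x, ψ (a * x ^ 2) = (quadraticChar F a : ℂ) * quadSum ψ := by
  have h1 := sum_addChar_mul_sq hF hψ (one_ne_zero)
  simp only [one_mul, AddChar.mulShift_one] at h1
  rw [quadSum, h1, sum_addChar_mul_sq hF hψ ha]
  have h2 := gaussSum_mulShift ((quadraticChar F).ringHomComp (Int.castRingHom ℂ)) ψ
    (Units.mk0 a ha)
  simp only [Units.val_mk0, MulChar.ringHomComp_apply, eq_intCast] at h2
  rw [← h2, ← mul_assoc]
  have h3 : (quadraticChar F a : ℂ) * quadraticChar F a = 1 := by
    have := quadraticChar_sq_one ha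
    rw [sq] at this
    exact_mod_cast this
  rw [h3, one_mul]

theorem quadSum_sq (hF : ringChar F ≠ 2) (hψ : ψ ≠ 1) :
    quadSum ψ ^ 2 = (quadraticChar F (-1) : ℂ) * Fintype.card F := by
  have h1 := sum_addChar_mul_sq hF hψ (one_ne_zero)
  simp only [one_mul, AddChar.mulShift_one] at h1
  rw [quadSum, h1, gaussSum_sq _ _ (AddChar.IsPrimitive.of_ne_one hψ)]
  · simp
  · obtain ⟨a, ha⟩ := quadraticChar_exists_neg_one' hF
    intro h
    have := DFunLike.congr_fun h (a : F)
    simp [ha] at this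
    norm_num at this
  · exact (quadraticChar_isQuadratic F).comp _

theorem norm_quadSum_sq (hF : ringChar F ≠ 2) (hψ : ψ ≠ 1) :
    ‖quadSum ψ‖ ^ 2 = Fintype.card F := by
  rw [← norm_pow, quadSum_sq hF hψ]
  rcases quadraticChar_dichotomy (neg_ne_zero.2 (one_ne_zero (α := F))) with h | h <;> simp [h]

/-- Complete the square with the shift `w ↦ w + 2az`. Read from right to left, this expands a
Gaussian in `z` into characters. -/
theorem sum_addChar_completed (hF : ringChar F ≠ 2) (hψ : ψ ≠ 1) {a : F} (ha : a ≠ 0) (z : F) :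
    ∑ w, ψ (-(w ^ 2 / (4 * a)) + w * z) = (quadraticChar F (-a) : ℂ) * quadSum ψ * ψ (a * z ^ 2) := by
  have h2 : (2 : F) ≠ 0 := Ring.two_ne_zero hF
  have h4 : (4 : F) ≠ 0 := by
    have : (4 : F) = 2 * 2 := by norm_num
    rw [this]; exact mul_ne_zero h2 h2
  have hc : -(1 / (4 * a)) ≠ 0 := neg_ne_zero.2 (one_div_ne_zero (mul_ne_zero h4 ha))
  have hq : quadraticChar F (-(1 / (4 * a))) = quadraticChar F (-a) := by
    have : -a = -(1 / (4 * a)) * (2 * a) ^ 2 := by field_simp; norm_num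
    rw [this, map_mul, quadraticChar_sq_one' (mul_ne_zero h2 ha), mul_one]
  rw [← hq, ← sum_addChar_mul_sq' hF hψ hc, sum_mul,
    ← Equiv.sum_comp (Equiv.addRight (2 * a * z))]
  refine sum_congr rfl fun w _ => ?_
  rw [← AddChar.map_add_eq_mul]
  congr 1
  simp only [Equiv.coe_addRight]
  field_simp
  ring

/-- A Gaussian in several variables as a superposition of characters. -/
theorem sum_addChar_diagonal (hF : ringChar F ≠ 2) (hψ : ψ ≠ 1) {c : ι → F} (hc : ∀ i, c i ≠ 0)
    {s : F} (hs : s ≠ 0) (z : ι → F) :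
    ∑ w : ι → F, ψ (-(∑ i, w i ^ 2 / c i) / (4 * s) + w ⬝ᵥ z) =
      (∏ i, (quadraticChar F (-(s * c i)) : ℂ)) * quadSum ψ ^ Fintype.card ι *
        ψ (s * ∑ i, c i * z i ^ 2) := by
  have h1 : ∀ w : ι → F, ψ (-(∑ i, w i ^ 2 / c i) / (4 * s) + w ⬝ᵥ z) =
      ∏ i, ψ (-(w i ^ 2 / (4 * (s * c i))) + w i * z i) := by
    intro w
    have := addChar_dotProduct ψ (fun _ => (1 : F))
      (fun i => -(w i ^ 2 / (4 * (s * c i))) + w i * z i)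
    simp only [one_mul] at this
    rw [← this]
    congr 1
    simp only [dotProduct, one_mul, sum_add_distrib, neg_div, sum_neg_distrib, sum_div]
    congr 2
    exact sum_congr rfl fun i _ => by rw [div_div]; congr 1; ring
  have h2 : ψ (s * ∑ i, c i * z i ^ 2) = ∏ i, ψ (s * c i * z i ^ 2) := by
    have := addChar_dotProduct ψ (fun _ => (1 : F)) (fun i => s * c i * z i ^ 2)
    simp only [one_mul] at this
    rw [← this, dotProduct, mul_sum]
    congr 1
    exact sum_congr rfl fun i _ => by ring
  rw [sum_congr rfl fun w _ => h1 w, h2, ← Finset.card_univ, ← prod_const, ← prod_mul_distrib,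
    ← prod_mul_distrib]
  have := prod_univ_sum (fun _ : ι => (univ : Finset F))
    (fun i w => ψ (-(w ^ 2 / (4 * (s * c i))) + w * z i))
  rw [Fintype.piFinset_univ] at this
  rw [← this]
  exact prod_congr rfl fun i _ => sum_addChar_completed hF hψ (mul_ne_zero hs (hc i)) (z i)

/-- For a diagonal quadratic form of elliptic type in an even number of variables, a set
has few pairs of points whose difference is isotropic. -/
theorem card_isotropic_pairs_le (hF : ringChar F ≠ 2) (hψ : ψ ≠ 1) {c : ι → F}
    (hc : ∀ i, c i ≠ 0) {m : ℕ} (hm : Fintype.card ι = 2 * m)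
    (hell : quadraticChar F ((-1) ^ m * ∏ i, c i) = -1) (X : Finset (ι → F)) :
    (Fintype.card F : ℝ) * #{p ∈ X ×ˢ X | ∑ i, c i * (p.1 i - p.2 i) ^ 2 = 0} ≤
      (#X : ℝ) ^ 2 + (Fintype.card F : ℝ) ^ m * #X := by
  set q : ℝ := (Fintype.card F : ℝ) with hq
  have hq0 : 0 < q := by rw [hq]; exact_mod_cast Fintype.card_pos
  have h4 : (4 : F) ≠ 0 := by
    have h2 : (2 : F) ≠ 0 := Ring.two_ne_zero hF
    have : (4 : F) = 2 * 2 := by norm_num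
    rw [this]; exact mul_ne_zero h2 h2
  -- With an even number of variables the dependence on `s` is through a square and disappears; the
  -- minus sign is ellipticity.
  have hconst : ∀ s : F, s ≠ 0 → (∏ i, (quadraticChar F (-(s * c i)) : ℂ)) *
      quadSum ψ ^ Fintype.card ι = -(q : ℂ) ^ m := by
    intro s hs
    have e1 : (∏ i, quadraticChar F (-(s * c i))) * quadraticChar F (-1) ^ m = -1 := by
      rw [← map_prod, ← map_pow, ← map_mul, ← hell]
      have : (∏ i, -(s * c i)) = (s ^ m) ^ 2 * ∏ i, c i := by
        rw [prod_congr rfl (g := fun i => (-s) * c i) fun i _ => by ring, prod_mul_distrib,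
          prod_const, Finset.card_univ, hm, Even.neg_pow (even_two_mul m)]
        ring
      rw [this, mul_assoc, map_mul, quadraticChar_sq_one' (pow_ne_zero _ hs), one_mul, mul_comm]
    have e2 : (∏ i, (quadraticChar F (-(s * c i)) : ℂ)) * (quadraticChar F (-1) : ℂ) ^ m = -1 := by
      exact_mod_cast e1
    rw [hm, pow_mul, quadSum_sq hF hψ, mul_pow, ← mul_assoc, e2, hq]
    simp
  have hgauss : ∀ s : F, s ≠ 0 → ∀ z : ι → F, -(q : ℂ) ^ m * ψ (s * ∑ i, c i * z i ^ 2) =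
      ∑ w : ι → F, ψ (-(∑ i, w i ^ 2 / c i) / (4 * s)) * ψ (w ⬝ᵥ z) := by
    intro s hs z
    rw [← hconst s hs, ← sum_addChar_diagonal hF hψ hc hs z]
    exact sum_congr rfl fun w _ => AddChar.map_add_eq_mul _ _ _
  -- The substitution `s ↦ -1/(4s)` permutes the nonzero elements.
  have hsum : ∀ a : F, ∑ s ∈ univ.erase (0 : F), ψ (-a / (4 * s)) =
      if a = 0 then (q : ℂ) - 1 else -1 := by
    intro a
    have e : ∑ s ∈ univ.erase (0 : F), ψ (-a / (4 * s)) = ∑ s ∈ univ.erase (0 : F), ψ (s * a) := by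
      refine sum_nbij' (fun s => -(1 / (4 * s))) (fun s => -(1 / (4 * s))) ?_ ?_ ?_ ?_ ?_
      · intro s hs
        simpa [h4] using hs
      · intro s hs
        simpa [h4] using hs
      · intro s hs
        have : s ≠ 0 := by simpa using hs
        field_simp
      · intro s hs
        have : s ≠ 0 := by simpa using hs
        field_simp
      · intro s hs
        congr 1
        ring
    rw [e, sum_erase_eq_sub (mem_univ _), sum_addChar_mul hψ]
    split_ifs <;> simp [hq]
  have hcount : ((q * #{p ∈ X ×ˢ X | ∑ i, c i * (p.1 i - p.2 i) ^ 2 = 0} : ℝ) : ℂ) =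
      (#X : ℂ) ^ 2 + ∑ s ∈ univ.erase (0 : F), ∑ x ∈ X, ∑ y ∈ X,
        ψ (s * ∑ i, c i * (x - y) i ^ 2) := by
    have e : ((q * #{p ∈ X ×ˢ X | ∑ i, c i * (p.1 i - p.2 i) ^ 2 = 0} : ℝ) : ℂ) =
        ∑ s, ∑ x ∈ X, ∑ y ∈ X, ψ (s * ∑ i, c i * (x - y) i ^ 2) := by
      rw [sum_comm]
      rw [sum_congr rfl fun x _ => sum_comm]
      simp only [sum_addChar_mul hψ]
      rw [card_filter, sum_product]
      push_cast
      rw [mul_sum]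
      refine sum_congr rfl fun x _ => ?_
      rw [mul_sum]
      refine sum_congr rfl fun y _ => ?_
      simp only [Pi.sub_apply]
      split_ifs <;> simp [hq]
    rw [e, ← add_sum_erase _ _ (mem_univ (0 : F))]
    simp [sq]
  have hkey : -(q : ℂ) ^ m * ∑ s ∈ univ.erase (0 : F), ∑ x ∈ X, ∑ y ∈ X,
        ψ (s * ∑ i, c i * (x - y) i ^ 2) =
      ((∑ w : ι → F, (if ∑ i, w i ^ 2 / c i = 0 then q - 1 else -1) *
        ‖∑ x ∈ X, ψ (w ⬝ᵥ x)‖ ^ 2 : ℝ) : ℂ) := by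
    have e : ∀ w : ι → F, ((if ∑ i, w i ^ 2 / c i = 0 then q - 1 else -1 : ℝ) : ℂ) *
        ((‖∑ x ∈ X, ψ (w ⬝ᵥ x)‖ ^ 2 : ℝ) : ℂ) = ∑ s ∈ univ.erase (0 : F), ∑ x ∈ X, ∑ y ∈ X,
          ψ (-(∑ i, w i ^ 2 / c i) / (4 * s)) * ψ (w ⬝ᵥ (x - y)) := by
      intro w
      rw [norm_sq_sum_addChar ψ X w]
      have h5 : ((if ∑ i, w i ^ 2 / c i = 0 then q - 1 else -1 : ℝ) : ℂ) =
          ∑ s ∈ univ.erase (0 : F), ψ (-(∑ i, w i ^ 2 / c i) / (4 * s)) := by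
        rw [hsum]; split_ifs <;> simp
      rw [h5, sum_mul]
      simp only [mul_sum]
    simp only [Complex.ofReal_sum, Complex.ofReal_mul _ (_ ^ 2), e]
    conv_rhs => rw [sum_comm]
    rw [mul_sum]
    refine sum_congr rfl fun s hs => ?_
    have hs0 : s ≠ 0 := by simpa using hs
    conv_rhs => rw [sum_comm]
    rw [mul_sum]
    refine sum_congr rfl fun x _ => ?_
    conv_rhs => rw [sum_comm]
    rw [mul_sum]
    exact sum_congr rfl fun y _ => hgauss s hs0 (x - y)
  set T : ℝ := ∑ w : ι → F, (if ∑ i, w i ^ 2 / c i = 0 then q - 1 else -1) *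
        ‖∑ x ∈ X, ψ (w ⬝ᵥ x)‖ ^ 2 with hT
  set N : ℝ := (#{p ∈ X ×ˢ X | ∑ i, c i * (p.1 i - p.2 i) ^ 2 = 0} : ℝ) with hN
  -- The decisive use of the sign: `T` enters the count with factor `-q^m`, so only a lower bound
  -- for `T` is needed. The weight `q - 1` on the dual cone can be discarded, and the weights are at
  -- least `-1`.
  have hTlow : -(q ^ (2 * m) * #X) ≤ T := by
    rw [← hm, ← sum_norm_sq_sum_addChar hψ X, ← sum_neg_distrib]
    refine sum_le_sum fun w _ => ?_
    rw [← neg_one_mul]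
    refine mul_le_mul_of_nonneg_right ?_ (by positivity)
    split_ifs <;> linarith
  have hfin : -q ^ m * (q * N - (#X : ℝ) ^ 2) = T := by
    have : -(q : ℂ) ^ m * (((q * N : ℝ) : ℂ) - (#X : ℂ) ^ 2) = (T : ℂ) := by
      rw [hcount, add_sub_cancel_left, hkey]
    exact_mod_cast this
  have h6 : q ^ m * (q * N - (#X : ℝ) ^ 2) ≤ q ^ m * (q ^ m * #X) := by
    have : q ^ (2 * m) = q ^ m * q ^ m := by ring
    nlinarith
  have := le_of_mul_le_mul_left h6 (by positivity)
  linarith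

end Fourier

/-! ### Additive energy on spheres of nonsquare radius. -/

section Energy

set_option linter.unusedSectionVars false

variable {F : Type*} [Field F] [Fintype F] [DecidableEq F] {ψ : AddChar F ℂ}

theorem two_le_card : (2 : ℝ) ≤ Fintype.card F := by
  exact_mod_cast Fintype.one_lt_card (α := F)

section Cone

variable {ι : Type*} [Fintype ι] [DecidableEq ι]

/-- No vector of `V` is a multiple of another one, and none is zero. -/
def DistinctDirections (V : Finset (ι → F)) : Prop :=
  ∀ u ∈ V, ∀ v ∈ V, ∀ t : F, u = t • v → t = 1

/-- The nonzero multiples of the vectors of `V`. -/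
def cone (V : Finset (ι → F)) : Finset (ι → F) :=
  (univ.erase (0 : F) ×ˢ V).image fun p => p.1 • p.2

theorem DistinctDirections.injOn {V : Finset (ι → F)} (hV : DistinctDirections V) :
    Set.InjOn (fun p : F × (ι → F) => p.1 • p.2) (univ.erase (0 : F) ×ˢ V : Finset _) := by
  rintro ⟨s, u⟩ hs ⟨t, v⟩ ht h
  simp only [coe_product, Set.mem_prod, mem_coe, mem_erase, mem_univ, and_true] at hs ht h
  have h1 : u = (s⁻¹ * t) • v := by rw [mul_smul, ← h, inv_smul_smul₀ hs.1]
  have h2 := hV u hs.2 v ht.2 _ h1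
  rw [h2, one_smul] at h1
  have h3 : t = s := by
    have := congrArg (s * ·) h2
    simpa [mul_inv_cancel_left₀ hs.1] using this
  rw [h1, h3]

theorem DistinctDirections.sum_cone {M : Type*} [AddCommMonoid M] {V : Finset (ι → F)}
    (hV : DistinctDirections V) (f : (ι → F) → M) :
    ∑ x ∈ cone V, f x = ∑ s ∈ univ.erase (0 : F), ∑ v ∈ V, f (s • v) := by
  rw [cone, sum_image hV.injOn, sum_product]

theorem card_erase_zero : (#(univ.erase (0 : F)) : ℝ) = Fintype.card F - 1 := by
  rw [card_erase_of_mem (mem_univ _), Finset.card_univ, Nat.cast_sub Fintype.card_pos, Nat.cast_one]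

theorem DistinctDirections.card_cone {V : Finset (ι → F)} (hV : DistinctDirections V) :
    (#(cone V) : ℝ) = (Fintype.card F - 1) * #V := by
  rw [cone, card_image_of_injOn hV.injOn, card_product, Nat.cast_mul, card_erase_zero]

/-- The number of orthogonal pairs in a set of vectors with distinct directions. -/
theorem DistinctDirections.card_orthogonal_pairs_le (hψ : ψ ≠ 1) {U : Finset (ι → F)}
    (hU : DistinctDirections U) :
    (Fintype.card F : ℝ) * #{p ∈ U ×ˢ U | p.1 ⬝ᵥ p.2 = 0} ≤
      (#U : ℝ) ^ 2 + √((Fintype.card F : ℝ) ^ Fintype.card ι) * #U := by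
  set q : ℝ := (Fintype.card F : ℝ) with hq
  have hq2 : 2 ≤ q := two_le_card
  set Y : (ι → F) → ℝ := fun w => q * #{v ∈ U | w ⬝ᵥ v = 0} - #U with hY
  -- The transform of the cone at `w` counts the vectors of `U` orthogonal to `w`, centred by its
  -- mean; it is invariant under dilation of `w`.
  have hhat : ∀ w, ∑ x ∈ cone U, ψ (w ⬝ᵥ x) = (Y w : ℂ) := by
    intro w
    rw [hU.sum_cone, sum_comm]
    have : ∀ v ∈ U, ∑ s ∈ univ.erase (0 : F), ψ (w ⬝ᵥ s • v) =
        (q : ℂ) * (if w ⬝ᵥ v = 0 then 1 else 0) - 1 := by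
      intro v _
      simp only [dotProduct_smul, smul_eq_mul]
      rw [sum_erase_eq_sub (mem_univ _), sum_addChar_mul hψ]
      split_ifs <;> simp [hq]
    rw [sum_congr rfl this, sum_sub_distrib, ← mul_sum]
    simp [hY]
  have hsmul : ∀ s ∈ univ.erase (0 : F), ∀ w, Y (s • w) = Y w := by
    intro s hs w
    have hs0 : s ≠ 0 := by simpa using hs
    simp [hY, smul_dotProduct, hs0]
  -- Parseval, keeping only the frequencies in the cone itself. The dilates give `q - 1` on the
  -- left, matching the size of the cone on the right.
  have h1 : (q - 1) * ∑ u ∈ U, Y u ^ 2 ≤ (q - 1) * (q ^ Fintype.card ι * #U) := by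
    have h2 := sum_norm_sq_sum_addChar hψ (cone U)
    rw [hU.card_cone, ← hq] at h2
    calc (q - 1) * ∑ u ∈ U, Y u ^ 2 = ∑ x ∈ cone U, Y x ^ 2 := by
          rw [hU.sum_cone, sum_congr rfl fun s hs => sum_congr rfl fun v _ => by rw [hsmul s hs],
            sum_const, nsmul_eq_mul, card_erase_zero]
      _ ≤ ∑ x, Y x ^ 2 := sum_le_univ_sum_of_nonneg fun x => sq_nonneg _
      _ = ∑ w, ‖∑ x ∈ cone U, ψ (w ⬝ᵥ x)‖ ^ 2 := by
          refine sum_congr rfl fun w _ => ?_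
          rw [hhat, Complex.norm_real, Real.norm_eq_abs, sq_abs]
      _ = _ := by rw [h2]; ring
  have h3 : ∑ u ∈ U, Y u ^ 2 ≤ q ^ Fintype.card ι * #U :=
    le_of_mul_le_mul_left h1 (by linarith)
  have h4 : ∑ u ∈ U, Y u = q * #{p ∈ U ×ˢ U | p.1 ⬝ᵥ p.2 = 0} - (#U : ℝ) ^ 2 := by
    simp only [hY, sum_sub_distrib, ← mul_sum, card_filter, sum_product]
    push_cast
    simp [sq]
  have h5 : (∑ u ∈ U, Y u) ^ 2 ≤ (√(q ^ Fintype.card ι) * #U) ^ 2 := by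
    refine sq_sum_le_card_mul_sum_sq.trans ?_
    rw [mul_pow, Real.sq_sqrt (by positivity)]
    nlinarith [Nat.cast_nonneg (α := ℝ) #U]
  have := le_of_sq_le_sq h5 (by positivity)
  linarith

end Cone

variable {d : ℕ}

theorem mem_sphere {g : F} {x : Fin d → F} : x ∈ sphere d g ↔ x ⬝ᵥ x = g := by
  simp [sphere, dotProduct, sq]

/-- The number of pairs of points of a set on a sphere of nonsquare radius that differ by an
isotropic vector. -/
theorem card_null_differences_le (hF : ringChar F ≠ 2) (hψ : ψ ≠ 1) {g : F}
    (hg : quadraticChar F g = -1) {k : ℕ} (hd : d = 4 * k + 1) {A : Finset (Fin d → F)}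
    (hA : A ⊆ sphere d g) :
    ((Fintype.card F : ℝ) - 1) *
        (Fintype.card F * #{p ∈ A ×ˢ A | (p.1 - p.2) ⬝ᵥ (p.1 - p.2) = 0} - (#A : ℝ) ^ 2) ≤
      (Fintype.card F : ℝ) ^ (2 * k + 1) * #A := by
  have hg0 : g ≠ 0 := by rintro rfl; simp at hg
  set V : Finset (Fin (d + 1) → F) := A.image (vecCons 1) with hV
  have hinj : Set.InjOn (vecCons (1 : F)) (A : Set (Fin d → F)) :=
    fun x _ y _ h => (vecCons_inj.1 h).2
  have hVcard : #V = #A := card_image_of_injOn hinj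
  have hVd : DistinctDirections V := by
    intro u hu v hv t h
    obtain ⟨a, -, rfl⟩ := mem_image.1 hu
    obtain ⟨b, -, rfl⟩ := mem_image.1 hv
    have := congrFun h 0
    simpa using this.symm
  -- Here `m = 2k + 1` is odd, so the signed discriminant `(-1)^m (-g)` equals `g`, a nonsquare.
  have h1 := card_isotropic_pairs_le (ι := Fin (d + 1)) hF hψ (c := vecCons (-g) fun _ => 1)
    (m := 2 * k + 1) (by
      intro i
      refine Fin.cases ?_ (fun j => ?_) i <;> simp [hg0])
    (by simp [hd]; ring) (by
      rw [Fin.prod_univ_succ]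
      simp [pow_succ, pow_mul, hg]) (cone V)
  -- Both lifted vectors are isotropic, so only the cross term survives: the form takes the value
  -- `st (a - b)·(a - b)`.
  have hQ : ∀ s ∈ univ.erase (0 : F), ∀ t ∈ univ.erase (0 : F), ∀ a ∈ A, ∀ b ∈ A,
      (∑ i, (vecCons (-g) (fun _ => 1) : Fin (d + 1) → F) i *
        ((s • vecCons 1 a) i - (t • vecCons 1 b) i) ^ 2 = 0 ↔ (a - b) ⬝ᵥ (a - b) = 0) := by
    intro s hs t ht a ha b hb
    have hs0 : s ≠ 0 := by simpa using hs
    have ht0 : t ≠ 0 := by simpa using ht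
    have ha' := mem_sphere.1 (hA ha)
    have hb' := mem_sphere.1 (hA hb)
    have e : ∑ i, (vecCons (-g) (fun _ => 1) : Fin (d + 1) → F) i *
        ((s • vecCons 1 a) i - (t • vecCons 1 b) i) ^ 2 = s * t * ((a - b) ⬝ᵥ (a - b)) := by
      have e1 : ∑ i, (vecCons (-g) (fun _ => 1) : Fin (d + 1) → F) i *
        ((s • vecCons 1 a) i - (t • vecCons 1 b) i) ^ 2 =
          -g * (s - t) ^ 2 + (s • a - t • b) ⬝ᵥ (s • a - t • b) := by
        rw [Fin.sum_univ_succ]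
        simp [dotProduct, sq]
      rw [e1]
      simp only [sub_dotProduct, dotProduct_sub, smul_dotProduct, dotProduct_smul, smul_eq_mul,
        ha', hb', dotProduct_comm b a]
      ring
    rw [e]
    simp [hs0, ht0]
  have h2 : (#{p ∈ cone V ×ˢ cone V | ∑ i, (vecCons (-g) (fun _ => 1) : Fin (d + 1) → F) i *
      (p.1 i - p.2 i) ^ 2 = 0} : ℝ) = ((Fintype.card F : ℝ) - 1) ^ 2 *
        #{p ∈ A ×ˢ A | (p.1 - p.2) ⬝ᵥ (p.1 - p.2) = 0} := by
    simp only [card_filter, sum_product]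
    push_cast
    simp only [hVd.sum_cone]
    simp only [hV, sum_image hinj]
    have e : ∀ s ∈ univ.erase (0 : F), (∑ a ∈ A, ∑ t ∈ univ.erase (0 : F), ∑ b ∈ A,
        if ∑ i, (vecCons (-g) (fun _ => 1) : Fin (d + 1) → F) i *
        ((s • vecCons 1 a) i - (t • vecCons 1 b) i) ^ 2 = 0 then (1 : ℝ) else 0) =
        ((Fintype.card F : ℝ) - 1) * ∑ a ∈ A, ∑ b ∈ A,
          if (a - b) ⬝ᵥ (a - b) = 0 then (1 : ℝ) else 0 := by
      intro s hs
      rw [mul_sum]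
      refine sum_congr rfl fun a ha => ?_
      rw [sum_congr rfl fun t ht => sum_congr rfl fun b hb =>
        if_congr (hQ s hs t ht a ha b hb) rfl rfl, sum_const, nsmul_eq_mul, card_erase_zero]
    rw [sum_congr rfl e, sum_const, nsmul_eq_mul, card_erase_zero]
    ring
  rw [h2, hVd.card_cone, hVcard] at h1
  have hq2 : (2 : ℝ) ≤ Fintype.card F := two_le_card
  set q : ℝ := (Fintype.card F : ℝ) with hq
  have hq1 : 0 < q - 1 := by linarith
  -- The count and the main term scale by `(q - 1)^2`, the error only by `q - 1`; this is the gain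
  -- from passing to the cone.
  refine le_of_mul_le_mul_left (a := q - 1) ?_ hq1
  nlinarith

/-- Additive energy of a set of vectors. -/
def energy (A : Finset (Fin d → F)) : ℕ :=
  #{p ∈ (A ×ˢ A) ×ˢ A ×ˢ A | p.1.1 + p.1.2 = p.2.1 + p.2.2}

/-- Three entries determine the fourth. -/
theorem energy_le_card_pow (A : Finset (Fin d → F)) : energy A ≤ #A ^ 3 := by
  have : #A ^ 3 = #(A ×ˢ A ×ˢ A) := by simp only [card_product]; ring
  rw [this, energy]
  refine card_le_card_of_injOn (fun p => (p.2.1, p.1.1, p.1.2)) ?_ ?_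
  · rintro ⟨⟨a, b⟩, c, e⟩ h
    simp at h ⊢
    tauto
  · rintro ⟨⟨a, b⟩, c, e⟩ h ⟨⟨a', b'⟩, c', e'⟩ h' hh
    simp only [coe_filter, mem_product, Set.mem_ofPred_eq, Prod.mk.injEq] at h h' hh ⊢
    obtain ⟨rfl, rfl, rfl⟩ := hh
    have := h.2.symm.trans h'.2
    simpa using this

/-- Substituting `e = a + b - c` into `e·e = g` leaves `2 (a - c)·(b - c) = 0`. -/
theorem energy_le_sum_right_angles {g : F} (hF : ringChar F ≠ 2) {A : Finset (Fin d → F)}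
    (hA : A ⊆ sphere d g) :
    energy A ≤ ∑ c ∈ A, #{p ∈ A ×ˢ A | (p.1 - c) ⬝ᵥ (p.2 - c) = 0} := by
  have : ∑ c ∈ A, #{p ∈ A ×ˢ A | (p.1 - c) ⬝ᵥ (p.2 - c) = 0} =
      #{p ∈ A ×ˢ A ×ˢ A | (p.2.1 - p.1) ⬝ᵥ (p.2.2 - p.1) = 0} := by
    simp only [card_filter, sum_product]
  rw [this, energy]
  refine card_le_card_of_injOn (fun p => (p.2.1, p.1.1, p.1.2)) ?_ ?_
  · rintro ⟨⟨a, b⟩, c, e⟩ h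
    simp only [coe_filter, mem_product, Set.mem_ofPred_eq] at h ⊢
    obtain ⟨⟨⟨ha, hb⟩, hc, he⟩, h⟩ := h
    refine ⟨⟨hc, ha, hb⟩, ?_⟩
    have e1 : e = a + b - c := by rw [h]; abel
    have ha' := mem_sphere.1 (hA ha)
    have hb' := mem_sphere.1 (hA hb)
    have hc' := mem_sphere.1 (hA hc)
    have he' := mem_sphere.1 (hA he)
    rw [e1] at he'
    simp only [sub_dotProduct, dotProduct_sub, add_dotProduct, dotProduct_add, ha', hb', hc',
      dotProduct_comm b a, dotProduct_comm c a, dotProduct_comm c b] at he' ⊢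
    have h2 : (2 : F) ≠ 0 := Ring.two_ne_zero hF
    refine (mul_eq_zero.1 (?_ : (2 : F) * _ = 0)).resolve_left h2
    linear_combination he'
  · rintro ⟨⟨a, b⟩, c, e⟩ h ⟨⟨a', b'⟩, c', e'⟩ h' hh
    simp only [coe_filter, mem_product, Set.mem_ofPred_eq, Prod.mk.injEq] at h h' hh ⊢
    obtain ⟨rfl, rfl, rfl⟩ := hh
    have := h.2.symm.trans h'.2
    simpa using this

/-- Right angles at `c` with both legs non-isotropic are orthogonal pairs of distinct directions;
those with an isotropic leg are counted trivially, leaving the other leg free. -/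
theorem card_right_angles_le (hψ : ψ ≠ 1) {g : F} {A : Finset (Fin d → F)}
    (hA : A ⊆ sphere d g) {c : Fin d → F} (hc : c ∈ A) :
    (Fintype.card F : ℝ) * #{p ∈ A ×ˢ A | (p.1 - c) ⬝ᵥ (p.2 - c) = 0} ≤
      (#A : ℝ) ^ 2 + √((Fintype.card F : ℝ) ^ d) * #A +
        2 * (Fintype.card F * #{a ∈ A | (c - a) ⬝ᵥ (c - a) = 0}) * #A := by
  set A₀ := {a ∈ A | (c - a) ⬝ᵥ (c - a) = 0} with hA₀
  set B := {a ∈ A | (a - c) ⬝ᵥ (a - c) ≠ 0} with hB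
  set U := B.image (· - c) with hU
  -- A line through `c` in a non-isotropic direction meets the sphere in at most one further point:
  -- `u·u = -2 u·c` fixes the multiple.
  have hUd : DistinctDirections U := by
    have key : ∀ u ∈ U, u ⬝ᵥ u ≠ 0 ∧ u ⬝ᵥ u = -2 * (u ⬝ᵥ c) := by
      intro u hu
      obtain ⟨a, ha, rfl⟩ := mem_image.1 hu
      obtain ⟨haA, ha⟩ := mem_filter.1 ha
      refine ⟨ha, ?_⟩
      simp only [sub_dotProduct, dotProduct_sub, mem_sphere.1 (hA haA), mem_sphere.1 (hA hc),
        dotProduct_comm c a]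
      ring
    intro u hu v hv t h
    obtain ⟨h1, h2⟩ := key u hu
    obtain ⟨h3, h4⟩ := key v hv
    rw [h] at h1 h2
    simp only [smul_dotProduct, dotProduct_smul, smul_eq_mul] at h1 h2
    have ht : t ≠ 0 := by rintro rfl; simp at h1
    have : t * (v ⬝ᵥ v) * (t - 1) = 0 := by linear_combination h2 - t * h4
    simpa [ht, h3, sub_eq_zero] using this
  have h1 := hUd.card_orthogonal_pairs_le hψ
  have hcard : #{p ∈ A ×ˢ A | (p.1 - c) ⬝ᵥ (p.2 - c) = 0} ≤
      #{p ∈ U ×ˢ U | p.1 ⬝ᵥ p.2 = 0} + #(A₀ ×ˢ A) + #(A ×ˢ A₀) := by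
    have hs : {p ∈ A ×ˢ A | (p.1 - c) ⬝ᵥ (p.2 - c) = 0} ⊆
        ({p ∈ B ×ˢ B | (p.1 - c) ⬝ᵥ (p.2 - c) = 0} ∪ (A₀ ×ˢ A)) ∪ (A ×ˢ A₀) := by
      have hneg : ∀ a : Fin d → F, (c - a) ⬝ᵥ (c - a) = (a - c) ⬝ᵥ (a - c) := fun a => by
        rw [← neg_sub a c, neg_dotProduct_neg]
      rintro ⟨a, b⟩ h
      simp only [hB, hA₀, mem_union, mem_filter, mem_product, hneg] at h ⊢
      tauto
    refine (card_le_card hs).trans ((card_union_le _ _).trans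
      (Nat.add_le_add_right ((card_union_le _ _).trans (Nat.add_le_add_right ?_ _)) _))
    refine card_le_card_of_injOn (fun p => (p.1 - c, p.2 - c)) ?_ ?_
    · rintro ⟨a, b⟩ h
      simp only [coe_filter, mem_product, Set.mem_ofPred_eq] at h ⊢
      exact ⟨⟨mem_image_of_mem _ h.1.1, mem_image_of_mem _ h.1.2⟩, h.2⟩
    · rintro ⟨a, b⟩ _ ⟨a', b'⟩ _ h
      simpa using h
  have hUA : #U ≤ #A := card_image_le.trans (card_filter_le _ _)
  have hUA' : (#U : ℝ) ≤ #A := by exact_mod_cast hUA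
  have hcard' : (#{p ∈ A ×ˢ A | (p.1 - c) ⬝ᵥ (p.2 - c) = 0} : ℝ) ≤
      #{p ∈ U ×ˢ U | p.1 ⬝ᵥ p.2 = 0} + #A₀ * #A + #A * #A₀ := by
    simp only [card_product] at hcard
    exact_mod_cast hcard
  rw [Fintype.card_fin] at h1
  calc _ ≤ (Fintype.card F : ℝ) * (#{p ∈ U ×ˢ U | p.1 ⬝ᵥ p.2 = 0} + #A₀ * #A + #A * #A₀) := by
        gcongr
    _ = (Fintype.card F : ℝ) * #{p ∈ U ×ˢ U | p.1 ⬝ᵥ p.2 = 0} +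
        2 * (Fintype.card F * #A₀) * #A := by ring
    _ ≤ (#U : ℝ) ^ 2 + √((Fintype.card F : ℝ) ^ d) * #U + 2 * (Fintype.card F * #A₀) * #A := by
        gcongr
    _ ≤ _ := by gcongr

/-- The additive energy estimate on spheres of nonsquare radius. -/
theorem card_mul_energy_le (hF : ringChar F ≠ 2) (hψ : ψ ≠ 1) {g : F}
    (hg : quadraticChar F g = -1) {k : ℕ} (hd : d = 4 * k + 1) {A : Finset (Fin d → F)}
    (hA : A ⊆ sphere d g) :
    (Fintype.card F : ℝ) * energy A ≤
      3 * (#A : ℝ) ^ 3 + 5 * √((Fintype.card F : ℝ) ^ d) * (#A : ℝ) ^ 2 := by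
  have h1 := card_null_differences_le hF hψ hg hd hA
  have h2 : (energy A : ℝ) ≤ ∑ c ∈ A, (#{p ∈ A ×ˢ A | (p.1 - c) ⬝ᵥ (p.2 - c) = 0} : ℝ) := by
    exact_mod_cast energy_le_sum_right_angles hF hA
  have h3 : (#{p ∈ A ×ˢ A | (p.1 - p.2) ⬝ᵥ (p.1 - p.2) = 0} : ℝ) =
      ∑ c ∈ A, (#{a ∈ A | (c - a) ⬝ᵥ (c - a) = 0} : ℝ) := by
    simp only [card_filter, sum_product]
    push_cast
    rfl
  have h4 := sum_le_sum fun c (hc : c ∈ A) => card_right_angles_le hψ hA hc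
  rw [← mul_sum, sum_add_distrib, sum_const, nsmul_eq_mul, ← sum_mul, ← mul_sum, ← mul_sum, ← h3]
    at h4
  set N : ℝ := (#{p ∈ A ×ˢ A | (p.1 - p.2) ⬝ᵥ (p.1 - p.2) = 0} : ℝ)
  have hq2 : (2 : ℝ) ≤ Fintype.card F := two_le_card
  set q : ℝ := (Fintype.card F : ℝ)
  set R := √(q ^ d)
  have hR : q ^ (2 * k) ≤ R := by
    refine Real.le_sqrt_of_sq_le ?_
    rw [← pow_mul, hd]
    exact pow_le_pow_right₀ (by linarith) (by omega)
  have h5 : q * N - (#A : ℝ) ^ 2 ≤ 2 * R * #A := by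
    refine le_of_mul_le_mul_left (a := q - 1) ?_ (by linarith)
    refine h1.trans ?_
    have : q ^ (2 * k + 1) ≤ (q - 1) * (2 * R) := by
      rw [pow_succ]
      have : 0 ≤ q ^ (2 * k) := by positivity
      nlinarith
    calc q ^ (2 * k + 1) * #A ≤ (q - 1) * (2 * R) * #A := by gcongr
      _ = _ := by ring
  have h6 : 2 * (q * N) * #A ≤ 2 * ((#A : ℝ) ^ 2 + 2 * R * #A) * #A := by
    gcongr
    linarith
  have h7 : q * energy A ≤ q * ∑ c ∈ A, (#{p ∈ A ×ˢ A | (p.1 - c) ⬝ᵥ (p.2 - c) = 0} : ℝ) := by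
    gcongr
  linarith

/-- Spheres in at least five dimensions have the expected size. -/
theorem card_pow_le_card_sphere (hF : ringChar F ≠ 2) (hψ : ψ ≠ 1) (hd : 5 ≤ d) (g : F) :
    (Fintype.card F : ℝ) ^ d ≤ 2 * (Fintype.card F * #(sphere d g)) := by
  have hq2 : (2 : ℝ) ≤ Fintype.card F := two_le_card
  have h1 : ((Fintype.card F * #(sphere d g) : ℝ) : ℂ) =
      (Fintype.card F : ℂ) ^ d + ∑ s ∈ univ.erase (0 : F), ∑ x : Fin d → F,
        ψ (s * (∑ i, x i ^ 2 - g)) := by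
    have e : ((Fintype.card F * #(sphere d g) : ℝ) : ℂ) =
        ∑ s, ∑ x : Fin d → F, ψ (s * (∑ i, x i ^ 2 - g)) := by
      rw [sum_comm]
      simp only [sum_addChar_mul hψ, sub_eq_zero]
      rw [← sum_filter, sum_const, nsmul_eq_mul, sphere]
      push_cast
      ring
    rw [e, ← add_sum_erase _ _ (mem_univ (0 : F))]
    simp
  -- The sum factors into `d` quadratic Gauss sums of modulus `√q`.
  have h2 : ∀ s ∈ univ.erase (0 : F), ‖∑ x : Fin d → F, ψ (s * (∑ i, x i ^ 2 - g))‖ ^ 2 =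
      (Fintype.card F : ℝ) ^ d := by
    intro s hs
    have hs0 : s ≠ 0 := by simpa using hs
    have e : ∑ x : Fin d → F, ψ (s * (∑ i, x i ^ 2 - g)) =
        ψ (-(s * g)) * ∏ _i : Fin d, ∑ y, ψ (s * y ^ 2) := by
      rw [prod_univ_sum, Fintype.piFinset_univ, mul_sum]
      refine sum_congr rfl fun x _ => ?_
      have := addChar_dotProduct ψ (fun _ => s) (fun i => x i ^ 2)
      rw [← this, ← AddChar.map_add_eq_mul, dotProduct, ← mul_sum]
      congr 1
      ring
    rw [e, prod_const, sum_addChar_mul_sq' hF hψ hs0, norm_mul, AddChar.norm_apply, one_mul,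
      norm_pow, norm_mul, ← pow_mul, mul_comm _ 2, pow_mul, mul_pow, norm_quadSum_sq hF hψ]
    rcases quadraticChar_dichotomy hs0 with h | h <;> simp [h]
  set q : ℝ := (Fintype.card F : ℝ) with hq
  have h3 : ‖∑ s ∈ univ.erase (0 : F), ∑ x : Fin d → F, ψ (s * (∑ i, x i ^ 2 - g))‖ ≤
      (q - 1) * √(q ^ d) := by
    rw [← card_erase_zero, ← nsmul_eq_mul]
    refine (norm_sum_le _ _).trans (sum_le_card_nsmul _ _ _ fun s hs => ?_)
    exact Real.le_sqrt_of_sq_le (h2 s hs).le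
  have h4 : 2 * ((q - 1) * √(q ^ d)) ≤ q ^ d := by
    have h5 : 2 * (q - 1) ≤ √(q ^ d) := by
      refine Real.le_sqrt_of_sq_le ?_
      calc (2 * (q - 1)) ^ 2 ≤ 2 ^ 2 * q ^ 2 := by rw [mul_pow]; gcongr <;> linarith
        _ ≤ q ^ 2 * q ^ 2 := by gcongr
        _ = q ^ 4 := by ring
        _ ≤ q ^ d := pow_le_pow_right₀ (by linarith) (by omega)
    calc 2 * ((q - 1) * √(q ^ d)) = 2 * (q - 1) * √(q ^ d) := by ring
      _ ≤ √(q ^ d) * √(q ^ d) := by gcongr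
      _ = q ^ d := Real.mul_self_sqrt (by positivity)
  have h6 : ‖((q * #(sphere d g) - q ^ d : ℝ) : ℂ)‖ ≤ (q - 1) * √(q ^ d) := by
    refine (congrArg norm (?_ : _ = _)).trans_le h3
    rw [Complex.ofReal_sub, h1, Complex.ofReal_pow, hq, Complex.ofReal_natCast]
    ring
  rw [Complex.norm_real, Real.norm_eq_abs] at h6
  have := (abs_le.1 h6).1
  linarith

/-- If a generator were a square, every unit would be one. -/
theorem IsPrimitiveElement.quadraticChar_eq_neg_one {g : F} (hF : ringChar F ≠ 2)
    (hg : IsPrimitiveElement g) : quadraticChar F g = -1 := by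
  obtain ⟨u, rfl, hu⟩ := hg
  rw [quadraticChar_neg_one_iff_not_isSquare]
  intro hsq
  obtain ⟨a, ha⟩ := quadraticChar_exists_neg_one' hF
  rw [quadraticChar_neg_one_iff_not_isSquare] at ha
  obtain ⟨n, rfl⟩ := Subgroup.mem_zpowers_iff.1 (hu a)
  apply ha
  obtain ⟨y, hy⟩ := hsq
  exact ⟨y ^ n, by rw [Units.val_zpow_eq_zpow_val, hy, mul_zpow]⟩

end Energy

/-! ### Geometric progressions and their minima. -/

section GeometricSums

/-- The largest term dominates, whatever the index set. -/
theorem sum_pow_le_of_forall_le {r Z : ℝ} (hr : 1 < r) (hZ : 0 ≤ Z) (s : Finset ℕ)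
    (hs : ∀ i ∈ s, r ^ i ≤ Z) : ∑ i ∈ s, r ^ i ≤ r / (r - 1) * Z := by
  have hr1 : 0 < r - 1 := by linarith
  rcases s.eq_empty_or_nonempty with rfl | hne
  · simp only [sum_empty]; positivity
  have hj := hs _ (s.max'_mem hne)
  set j := s.max' hne
  have hsub : s ⊆ range (j + 1) := fun i hi => mem_range.2 (Nat.lt_succ_of_le (s.le_max' i hi))
  calc ∑ i ∈ s, r ^ i ≤ ∑ i ∈ range (j + 1), r ^ i :=
        sum_le_sum_of_subset_of_nonneg hsub fun i _ _ => by positivity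
    _ = (r * r ^ j - 1) / (r - 1) := by rw [geom_sum_eq hr.ne', pow_succ']
    _ ≤ r * Z / (r - 1) := by
        gcongr
        nlinarith
    _ = _ := by ring

theorem sum_mul_pow_le_of_forall_le {c r Z : ℝ} (hr0 : 0 < r) (hr : r < 1) (hc : 0 ≤ c)
    (hZ : 0 ≤ Z) (s : Finset ℕ) (hs : ∀ i ∈ s, c * r ^ i ≤ Z) :
    ∑ i ∈ s, c * r ^ i ≤ 1 / (1 - r) * Z := by
  have hr1 : 0 < 1 - r := by linarith
  rcases s.eq_empty_or_nonempty with rfl | hne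
  · simp only [sum_empty]; positivity
  have hj := hs _ (s.min'_mem hne)
  set j := s.min' hne
  have hle : ∀ i ∈ s, j ≤ i := fun i hi => s.min'_le i hi
  calc ∑ i ∈ s, c * r ^ i = c * r ^ j * ∑ i ∈ s, r ^ (i - j) := by
        rw [mul_sum]
        refine sum_congr rfl fun i hi => ?_
        rw [mul_assoc, ← pow_add, Nat.add_sub_cancel' (hle i hi)]
    _ = c * r ^ j * ∑ l ∈ s.image (· - j), r ^ l := by
        rw [sum_image]
        intro a ha b hb h
        have := hle a ha
        have := hle b hb
        simp only at h
        omega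
    _ ≤ c * r ^ j * (1 - r)⁻¹ := by
        gcongr
        rw [← tsum_geometric_of_lt_one hr0.le hr]
        exact (summable_geometric_of_lt_one hr0.le hr).sum_le_tsum _ fun i _ => by positivity
    _ ≤ Z * (1 - r)⁻¹ := by gcongr
    _ = _ := by ring

/-- A sum of minima of an increasing and a decreasing geometric progression is governed by the
point where they cross. -/
theorem exists_sum_min_le {α β : ℝ} (hα : 0 < α) (hβ : 0 < β) :
    ∃ C : ℝ, 0 < C ∧ ∀ Y : ℝ, 0 < Y → ∀ n : ℕ,
      ∑ i ∈ range n, min (((2 : ℝ) ^ α) ^ i) (Y * ((2 : ℝ) ^ (-β)) ^ i) ≤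
        C * Y ^ (α / (α + β)) := by
  have hr : 1 < (2 : ℝ) ^ α := Real.one_lt_rpow (by norm_num) hα
  have hρ0 : 0 < (2 : ℝ) ^ (-β) := by positivity
  have hρ : (2 : ℝ) ^ (-β) < 1 := Real.rpow_lt_one_of_one_lt_of_neg (by norm_num) (by linarith)
  have hr1 : 0 < (2 : ℝ) ^ α - 1 := by linarith
  have hρ1 : 0 < 1 - (2 : ℝ) ^ (-β) := by linarith
  refine ⟨(2 : ℝ) ^ α / ((2 : ℝ) ^ α - 1) + 1 / (1 - (2 : ℝ) ^ (-β)), by positivity,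
    fun Y hY n => ?_⟩
  set Z := Y ^ (α / (α + β)) with hZ
  have hZ0 : 0 < Z := by positivity
  have hab : 0 < α + β := by linarith
  have hpow : ∀ (γ : ℝ) (i : ℕ), ((2 : ℝ) ^ γ) ^ i = ((2 : ℝ) ^ (i : ℝ)) ^ γ := fun γ i => by
    rw [← Real.rpow_natCast, ← Real.rpow_mul (by norm_num), ← Real.rpow_mul (by norm_num), mul_comm]
  -- The progressions cross where `2^(i(α+β)) = Y`, with common value `Z`.
  rw [← sum_filter_add_sum_filter_not (range n) (fun i => ((2 : ℝ) ^ (i : ℝ)) ^ (α + β) ≤ Y), add_mul]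
  refine add_le_add ?_ ?_
  · refine (sum_le_sum fun i _ => min_le_left _ _).trans
      (sum_pow_le_of_forall_le hr hZ0.le _ fun i hi => ?_)
    have h := (mem_filter.1 hi).2
    rw [hpow, hZ]
    calc ((2 : ℝ) ^ (i : ℝ)) ^ α = (((2 : ℝ) ^ (i : ℝ)) ^ (α + β)) ^ (α / (α + β)) := by
          rw [← Real.rpow_mul (by positivity) (α + β), mul_div_cancel₀ _ hab.ne']
      _ ≤ _ := by gcongr
  · refine (sum_le_sum fun i _ => min_le_right _ _).trans
      (sum_mul_pow_le_of_forall_le hρ0 hρ hY.le hZ0.le _ fun i hi => ?_)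
    have h := not_le.1 (mem_filter.1 hi).2
    rw [hpow, hZ]
    calc Y * ((2 : ℝ) ^ (i : ℝ)) ^ (-β) =
          Y * (((2 : ℝ) ^ (i : ℝ)) ^ (α + β)) ^ (-β / (α + β)) := by
          rw [← Real.rpow_mul (by positivity) (α + β), mul_div_cancel₀ _ hab.ne']
      _ ≤ Y * Y ^ (-β / (α + β)) := by
          gcongr ?_ * ?_
          exact Real.rpow_le_rpow_of_nonpos hY h.le
            (div_nonpos_of_nonpos_of_nonneg (by linarith) hab.le)
      _ = Y ^ (1 + -β / (α + β)) := by rw [Real.rpow_add hY, Real.rpow_one]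
      _ = _ := by congr 1; field_simp; ring

end GeometricSums

/-! ### The fourth moment as an additive energy. -/

section FourthMoment

set_option linter.unusedSectionVars false

variable {F : Type*} [Field F] [Fintype F] [DecidableEq F] {d : ℕ} {χ : AddChar F ℂ}

/-- Parseval with possibly repeated frequencies `φ i`, so that it applies to the square of an
exponential sum, indexed by pairs. -/
theorem sum_norm_sq_sum_mul (hχ : χ ≠ 1) {κ : Type*} (I : Finset κ) (φ : κ → Fin d → F)
    (w : κ → ℂ) :
    ((∑ m : Fin d → F, ‖∑ i ∈ I, χ (m ⬝ᵥ φ i) * w i‖ ^ 2 : ℝ) : ℂ) =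
      (Fintype.card F : ℂ) ^ d * ∑ i ∈ I, ∑ j ∈ I,
        if φ i = φ j then w i * (starRingEnd ℂ) (w j) else 0 := by
  have e : ∀ m : Fin d → F, ((‖∑ i ∈ I, χ (m ⬝ᵥ φ i) * w i‖ ^ 2 : ℝ) : ℂ) =
      ∑ i ∈ I, ∑ j ∈ I, χ (m ⬝ᵥ (φ i - φ j)) * (w i * (starRingEnd ℂ) (w j)) := by
    intro m
    rw [← Complex.normSq_eq_norm_sq, ← Complex.mul_conj, map_sum, sum_mul_sum]
    refine sum_congr rfl fun i _ => sum_congr rfl fun j _ => ?_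
    rw [map_mul, ← AddChar.map_neg_eq_conj, dotProduct_sub, sub_eq_add_neg,
      AddChar.map_add_eq_mul]
    ring
  rw [Complex.ofReal_sum, sum_congr rfl fun m _ => e m, sum_comm, mul_sum]
  refine sum_congr rfl fun i _ => ?_
  rw [sum_comm, mul_sum]
  refine sum_congr rfl fun j _ => ?_
  rw [← sum_mul, sum_addChar_dotProduct hχ, Fintype.card_fin]
  simp only [sub_eq_zero]
  split_ifs <;> simp

theorem sum_norm_pow_four (hχ : χ ≠ 1) (V : Finset (Fin d → F)) (f : (Fin d → F) → ℂ) :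
    ((∑ m : Fin d → F, ‖∑ x ∈ V, χ (m ⬝ᵥ x) * f x‖ ^ 4 : ℝ) : ℂ) =
      (Fintype.card F : ℂ) ^ d * ∑ i ∈ V ×ˢ V, ∑ j ∈ V ×ˢ V,
        if i.1 + i.2 = j.1 + j.2 then
          f i.1 * f i.2 * (starRingEnd ℂ) (f j.1 * f j.2) else 0 := by
  rw [← sum_norm_sq_sum_mul hχ (V ×ˢ V) (fun i => i.1 + i.2) (fun i => f i.1 * f i.2)]
  congr 1
  refine sum_congr rfl fun m _ => ?_
  rw [show 4 = 2 * 2 from rfl, pow_mul, ← norm_pow, sq (∑ x ∈ V, _), sum_mul_sum, sum_product]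
  congr 2
  refine sum_congr rfl fun a _ => sum_congr rfl fun b _ => ?_
  rw [dotProduct_add, AddChar.map_add_eq_mul]
  ring

/-- The expansion over `x + y = z + w` has nonnegative coefficients, so replacing `f` by a pointwise
majorant of its modulus can only increase it. -/
theorem sum_norm_pow_four_mono (hχ : χ ≠ 1) {V : Finset (Fin d → F)} {f : (Fin d → F) → ℂ}
    {g : (Fin d → F) → ℝ} (hfg : ∀ x ∈ V, ‖f x‖ ≤ g x) :
    ∑ m : Fin d → F, ‖∑ x ∈ V, χ (m ⬝ᵥ x) * f x‖ ^ 4 ≤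
      ∑ m : Fin d → F, ‖∑ x ∈ V, χ (m ⬝ᵥ x) * (g x : ℂ)‖ ^ 4 := by
  have hg : ∑ m : Fin d → F, ‖∑ x ∈ V, χ (m ⬝ᵥ x) * (g x : ℂ)‖ ^ 4 =
      (Fintype.card F : ℝ) ^ d * ∑ i ∈ V ×ˢ V, ∑ j ∈ V ×ˢ V,
        if i.1 + i.2 = j.1 + j.2 then g i.1 * g i.2 * (g j.1 * g j.2) else 0 := by
    have := sum_norm_pow_four hχ V fun x => (g x : ℂ)
    simp only [map_mul, Complex.conj_ofReal] at this
    rw [← Complex.ofReal_inj, this]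
    push_cast
    congr 1
    refine sum_congr rfl fun i _ => sum_congr rfl fun j _ => ?_
    split_ifs <;> simp
  have hf := congrArg norm (sum_norm_pow_four hχ V f)
  rw [Complex.norm_real, Real.norm_of_nonneg (by positivity)] at hf
  rw [hf, hg, norm_mul, norm_pow, Complex.norm_natCast]
  gcongr
  refine (norm_sum_le _ _).trans (sum_le_sum fun i hi => ?_)
  refine (norm_sum_le _ _).trans (sum_le_sum fun j hj => ?_)
  rw [mem_product] at hi hj
  split_ifs
  · rw [norm_mul, norm_mul, Complex.norm_conj, norm_mul]
    have h1 := hfg _ hi.1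
    have h2 := hfg _ hi.2
    have h3 := hfg _ hj.1
    have h4 := hfg _ hj.2
    have := (norm_nonneg _).trans h1
    have := (norm_nonneg _).trans h2
    have := (norm_nonneg _).trans h3
    have := mul_nonneg ‹0 ≤ g i.1› ‹0 ≤ g i.2›
    gcongr
  · simp

theorem sum_norm_pow_four_eq_energy (hχ : χ ≠ 1) (A : Finset (Fin d → F)) :
    ∑ m : Fin d → F, ‖∑ x ∈ A, χ (m ⬝ᵥ x)‖ ^ 4 = (Fintype.card F : ℝ) ^ d * energy A := by
  have := sum_norm_pow_four hχ A fun _ => 1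
  simp only [mul_one, map_one] at this
  rw [energy, card_filter, sum_product, ← Complex.ofReal_inj, this]
  push_cast
  congr 1
  refine sum_congr rfl fun i _ => sum_congr rfl fun j _ => ?_
  split_ifs <;> simp

theorem countingNorm_four (h : (Fin d → F) → ℂ) :
    countingNorm 4 h = ‖WithLp.toLp (4 : ENNReal) h‖ := by
  rw [PiLp.norm_eq_sum (by norm_num), countingNorm]
  simp

theorem countingNorm_four_pow (h : (Fin d → F) → ℂ) :
    countingNorm 4 h ^ 4 = ∑ m, ‖h m‖ ^ 4 := by
  rw [countingNorm, ← Real.rpow_natCast, ← Real.rpow_mul (by positivity)]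
  norm_num

theorem countingNorm_nonneg (r : ℝ) (h : (Fin d → F) → ℂ) : 0 ≤ countingNorm r h := by
  unfold countingNorm; positivity

theorem countingNorm_extension_pow (V : Finset (Fin d → F)) (f : (Fin d → F) → ℂ) :
    countingNorm 4 (extension χ V f) ^ 4 =
      ((#V : ℝ)⁻¹) ^ 4 * ∑ m : Fin d → F, ‖∑ x ∈ V, χ (m ⬝ᵥ x) * f x‖ ^ 4 := by
  rw [countingNorm_four_pow, mul_sum]
  refine sum_congr rfl fun m _ => ?_
  rw [extension, norm_mul, mul_pow, norm_inv, Complex.norm_natCast]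
  rfl

theorem countingNorm_extension_mono (hχ : χ ≠ 1) {V : Finset (Fin d → F)}
    {f : (Fin d → F) → ℂ} {g : (Fin d → F) → ℝ} (hfg : ∀ x ∈ V, ‖f x‖ ≤ g x) :
    countingNorm 4 (extension χ V f) ≤ countingNorm 4 (extension χ V fun x => (g x : ℂ)) := by
  refine le_of_pow_le_pow_left₀ (by norm_num : 4 ≠ 0) (countingNorm_nonneg _ _) ?_
  rw [countingNorm_extension_pow, countingNorm_extension_pow]
  exact mul_le_mul_of_nonneg_left (sum_norm_pow_four_mono hχ hfg) (by positivity)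

theorem countingNorm_extension_indicator_pow (hχ : χ ≠ 1) {V A : Finset (Fin d → F)}
    (hA : A ⊆ V) :
    countingNorm 4 (extension χ V fun x => if x ∈ A then 1 else 0) ^ 4 =
      ((#V : ℝ)⁻¹) ^ 4 * ((Fintype.card F : ℝ) ^ d * energy A) := by
  rw [countingNorm_extension_pow, ← sum_norm_pow_four_eq_energy hχ]
  congr 1
  refine sum_congr rfl fun m _ => ?_
  simp only [mul_ite, mul_one, mul_zero]
  rw [← sum_filter, filter_mem_eq_inter, inter_eq_right.2 hA]

theorem countingNorm_extension_sum_le (V : Finset (Fin d → F)) (s : Finset ℕ) (c : ℕ → ℝ)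
    (hc : ∀ i, 0 ≤ c i) (f : ℕ → (Fin d → F) → ℂ) :
    countingNorm 4 (extension χ V fun x => ∑ i ∈ s, (c i : ℂ) * f i x) ≤
      ∑ i ∈ s, c i * countingNorm 4 (extension χ V (f i)) := by
  have e : extension χ V (fun x => ∑ i ∈ s, (c i : ℂ) * f i x) =
      ∑ i ∈ s, (c i : ℂ) • extension χ V (f i) := by
    ext m
    rw [Finset.sum_apply]
    simp only [extension, Pi.smul_apply, smul_eq_mul, mul_sum]
    rw [sum_comm]
    exact sum_congr rfl fun i _ => sum_congr rfl fun x _ => by ring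
  have : Fact ((1 : ENNReal) ≤ 4) := ⟨by norm_num⟩
  simp only [countingNorm_four]
  rw [e, WithLp.toLp_sum]
  refine (norm_sum_le _ _).trans (sum_le_sum fun i _ => ?_)
  rw [WithLp.toLp_smul, norm_smul, Complex.norm_real, Real.norm_of_nonneg (hc i)]

end FourthMoment

/-! ### From level sets to the extension estimate. -/

section Restriction

set_option linter.unusedSectionVars false

variable {F : Type*} [Field F] [Fintype F] [DecidableEq F] {d : ℕ} {χ : AddChar F ℂ}

theorem rpow_pow_four {x : ℝ} (hx : 0 ≤ x) (t : ℝ) : (x ^ t) ^ 4 = x ^ (4 * t) := by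
  rw [← Real.rpow_natCast, ← Real.rpow_mul hx]
  congr 1
  push_cast
  ring

/-- The restricted form of the extension estimate. -/
theorem countingNorm_extension_indicator_le (hF : ringChar F ≠ 2) (hχ : χ ≠ 1) {g : F}
    (hg : quadraticChar F g = -1) {k : ℕ} (hd : d = 4 * k + 1) {A : Finset (Fin d → F)}
    (hA : A ⊆ sphere d g) :
    countingNorm 4 (extension χ (sphere d g) fun x => if x ∈ A then 1 else 0) ≤
      (#(sphere d g) : ℝ)⁻¹ * (2 * (Fintype.card F : ℝ) ^ ((d : ℝ) / 4)) *
        ((Fintype.card F : ℝ) ^ (-(1 / 4) : ℝ) * (#A : ℝ) ^ (3 / 4 : ℝ) +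
          min ((#A : ℝ) ^ (3 / 4 : ℝ))
            ((Fintype.card F : ℝ) ^ (((d : ℝ) - 2) / 8) * (#A : ℝ) ^ (1 / 2 : ℝ))) := by
  have h1 := card_mul_energy_le hF hχ hg hd hA
  have h2 : (energy A : ℝ) ≤ (#A : ℝ) ^ 3 := by exact_mod_cast energy_le_card_pow A
  have hq2 : (2 : ℝ) ≤ Fintype.card F := two_le_card
  set q : ℝ := (Fintype.card F : ℝ)
  have hq0 : 0 < q := by linarith
  set a : ℝ := (#A : ℝ)
  have ha0 : 0 ≤ a := Nat.cast_nonneg _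
  set X := q ^ (-(1 / 4) : ℝ) * a ^ (3 / 4 : ℝ) with hX
  set Y := min (a ^ (3 / 4 : ℝ)) (q ^ (((d : ℝ) - 2) / 8) * a ^ (1 / 2 : ℝ)) with hY
  have hX0 : 0 ≤ X := by positivity
  have hY0 : 0 ≤ Y := by positivity
  have hX4 : X ^ 4 = a ^ 3 / q := by
    rw [hX, mul_pow, rpow_pow_four hq0.le, rpow_pow_four ha0]
    norm_num
    rw [Real.rpow_neg_one]
    ring
  -- The constant `16 = 2^4` exceeds both `3` and `5`, and its fourth root is the `2` in the
  -- statement.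
  have hE : (energy A : ℝ) ≤ 16 * (X ^ 4 + Y ^ 4) := by
    rcases min_choice (a ^ (3 / 4 : ℝ)) (q ^ (((d : ℝ) - 2) / 8) * a ^ (1 / 2 : ℝ)) with h | h
    · have : Y ^ 4 = a ^ 3 := by
        rw [hY, h, rpow_pow_four ha0]
        norm_num
      rw [this]
      have : 0 ≤ X ^ 4 := pow_nonneg hX0 4
      have : 0 ≤ a ^ 3 := pow_nonneg ha0 3
      linarith
    · have e : Y ^ 4 = √(q ^ d) * a ^ 2 / q := by
        rw [hY, h, mul_pow, rpow_pow_four hq0.le, rpow_pow_four ha0, Real.sqrt_eq_rpow,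
          ← Real.rpow_natCast q d, ← Real.rpow_mul hq0.le,
          show 4 * (((d : ℝ) - 2) / 8) = (d : ℝ) * (1 / 2) - 1 by ring, Real.rpow_sub_one hq0.ne']
        norm_num
        ring
      rw [e, hX4, ← add_div, ← mul_div_assoc, le_div_iff₀ hq0]
      have : 0 ≤ √(q ^ d) * a ^ 2 := mul_nonneg (Real.sqrt_nonneg _) (pow_nonneg ha0 2)
      have : 0 ≤ a ^ 3 := pow_nonneg ha0 3
      linarith
  refine le_of_pow_le_pow_left₀ (by norm_num : 4 ≠ 0) (by positivity) ?_
  rw [countingNorm_extension_indicator_pow hχ hA, mul_pow, mul_pow, mul_pow, rpow_pow_four hq0.le,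
    mul_div_cancel₀ (d : ℝ) (by norm_num : (4 : ℝ) ≠ 0), Real.rpow_natCast]
  have h3 : X ^ 4 + Y ^ 4 ≤ (X + Y) ^ 4 := by
    have : 0 ≤ 4 * X ^ 3 * Y + 6 * X ^ 2 * Y ^ 2 + 4 * X * Y ^ 3 := by positivity
    linarith [show (X + Y) ^ 4 = X ^ 4 + Y ^ 4 + (4 * X ^ 3 * Y + 6 * X ^ 2 * Y ^ 2 +
      4 * X * Y ^ 3) by ring]
  calc _ ≤ (#(sphere d g) : ℝ)⁻¹ ^ 4 * (q ^ d * (16 * (X + Y) ^ 4)) := by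
        gcongr
        linarith
    _ = _ := by ring

/-- Decomposition of a function into dyadic level sets. -/
theorem exists_dyadic_levels (V : Finset (Fin d → F)) (f : (Fin d → F) → ℂ) {p : ℝ} (hp : 0 < p)
    (hf : ∑ x ∈ V, ‖f x‖ ^ p ≤ 1) :
    ∃ (n : ℕ) (A : ℕ → Finset (Fin d → F)), (∀ i, A i ⊆ V) ∧
      (∀ i, (#(A i) : ℝ) ≤ ((2 : ℝ) ^ (i + 1)) ^ p) ∧
      ∀ x ∈ V, ‖f x‖ ≤ ∑ i ∈ range n, (1 / 2 : ℝ) ^ i * (if x ∈ A i then 1 else 0) := by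
  have hle : ∀ x ∈ V, ‖f x‖ ≤ 1 := by
    intro x hx
    by_contra! h
    have h1 := Real.one_lt_rpow h hp
    have h2 := single_le_sum (f := fun x => ‖f x‖ ^ p) (fun x _ => by positivity) hx
    linarith
  have hlev : ∀ x, ∃ i : ℕ, x ∈ V → f x ≠ 0 → (1 / 2 : ℝ) ^ (i + 1) < ‖f x‖ ∧
      ‖f x‖ ≤ (1 / 2 : ℝ) ^ i := by
    intro x
    by_cases hx : x ∈ V ∧ f x ≠ 0
    · obtain ⟨i, hi⟩ := exists_nat_pow_near_of_lt_one (norm_pos_iff.2 hx.2) (hle x hx.1)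
        (by norm_num : (0 : ℝ) < 1 / 2) (by norm_num)
      exact ⟨i, fun _ _ => hi⟩
    · exact ⟨0, fun h1 h2 => absurd ⟨h1, h2⟩ hx⟩
  choose l hl using hlev
  refine ⟨V.sup l + 1, fun i => {x ∈ V | (1 / 2 : ℝ) ^ (i + 1) < ‖f x‖ ∧ ‖f x‖ ≤ (1 / 2 : ℝ) ^ i},
    fun i => filter_subset _ _, fun i => ?_, fun x hx => ?_⟩
  · set A := {x ∈ V | (1 / 2 : ℝ) ^ (i + 1) < ‖f x‖ ∧ ‖f x‖ ≤ (1 / 2 : ℝ) ^ i} with hA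
    have h1 : (#A : ℝ) * ((1 / 2 : ℝ) ^ (i + 1)) ^ p ≤ 1 := by
      refine le_trans ?_ hf
      rw [← nsmul_eq_mul]
      refine (card_nsmul_le_sum A (fun x => ‖f x‖ ^ p) _ fun x hx => ?_).trans
        (sum_le_sum_of_subset_of_nonneg (filter_subset _ _) fun x _ _ => by positivity)
      have := (mem_filter.1 hx).2.1
      gcongr
    have h2 : ((1 / 2 : ℝ) ^ (i + 1)) ^ p * ((2 : ℝ) ^ (i + 1)) ^ p = 1 := by
      rw [← Real.mul_rpow (by positivity) (by positivity), ← mul_pow]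
      norm_num
    calc (#A : ℝ) = #A * ((1 / 2 : ℝ) ^ (i + 1)) ^ p * ((2 : ℝ) ^ (i + 1)) ^ p := by
          rw [mul_assoc, h2, mul_one]
      _ ≤ 1 * ((2 : ℝ) ^ (i + 1)) ^ p := by gcongr
      _ = _ := one_mul _
  · by_cases h0 : f x = 0
    · rw [h0, norm_zero]
      positivity
    · have h1 := hl x hx h0
      refine h1.2.trans ?_
      have hmem : l x ∈ range (V.sup l + 1) := mem_range.2 (Nat.lt_succ_of_le (le_sup hx))
      refine le_trans (le_of_eq ?_) (single_le_sum (fun i _ => ?_) hmem)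
      · rw [if_pos (mem_filter.2 ⟨hx, h1⟩), mul_one]
      · positivity

/-- The factor `4` absorbs the `2^(pt)` caused by `i + 1` in the size of a level set. -/
theorem half_pow_mul_rpow_le {a p t : ℝ} {i : ℕ} (ha0 : 0 ≤ a) (ht : 0 ≤ t) (hpt : p * t ≤ 2)
    (ha : a ≤ ((2 : ℝ) ^ (i + 1)) ^ p) :
    (1 / 2 : ℝ) ^ i * a ^ t ≤ 4 * ((2 : ℝ) ^ (p * t - 1)) ^ i := by
  have h1 : a ^ t ≤ ((2 : ℝ) ^ (p * t)) ^ (i + 1) := by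
    refine (Real.rpow_le_rpow ha0 ha ht).trans (le_of_eq ?_)
    rw [← Real.rpow_mul (by positivity), ← Real.rpow_natCast, ← Real.rpow_natCast,
      ← Real.rpow_mul (by positivity), ← Real.rpow_mul (by positivity), mul_comm]
  have h2 : (2 : ℝ) ^ (p * t) ≤ 4 := by
    refine (Real.rpow_le_rpow_of_exponent_le (by norm_num) hpt).trans (le_of_eq ?_)
    norm_num
  calc (1 / 2 : ℝ) ^ i * a ^ t ≤ (1 / 2 : ℝ) ^ i * ((2 : ℝ) ^ (p * t)) ^ (i + 1) := by gcongr
    _ = (2 : ℝ) ^ (p * t) * ((2 : ℝ) ^ (p * t - 1)) ^ i := by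
        rw [pow_succ, Real.rpow_sub_one (by norm_num), div_pow, div_pow, one_pow]
        ring
    _ ≤ _ := by gcongr

/-- The extension estimate for normalized functions. -/
theorem countingNorm_extension_le_of_sum_le_one (hF : ringChar F ≠ 2) (hχ : χ ≠ 1) {g : F}
    (hg : quadraticChar F g = -1) {k : ℕ} (hk : 1 ≤ k) (hd : d = 4 * k + 1) {p θ β C₁ C₂ : ℝ}
    (hp : p = 4 * (d : ℝ) / (3 * (d : ℝ) - 2)) (hθ : θ = 2 / (3 * (d : ℝ) - 2))
    (hβ : β = ((d : ℝ) - 2) / (3 * (d : ℝ) - 2)) (hC₁0 : 0 < C₁) (hC₂0 : 0 < C₂)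
    (hC₁ : ∀ Y : ℝ, 0 < Y → ∀ n : ℕ,
      ∑ i ∈ range n, min (((2 : ℝ) ^ θ) ^ i) (Y * ((2 : ℝ) ^ (-1 : ℝ)) ^ i) ≤
        C₁ * Y ^ (θ / (θ + 1)))
    (hC₂ : ∀ Y : ℝ, 0 < Y → ∀ n : ℕ,
      ∑ i ∈ range n, min (((2 : ℝ) ^ θ) ^ i) (Y * ((2 : ℝ) ^ (-β)) ^ i) ≤
        C₂ * Y ^ (θ / (θ + β)))
    (f : (Fin d → F) → ℂ) (hf : ∑ x ∈ sphere d g, ‖f x‖ ^ p ≤ 1) :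
    countingNorm 4 (extension χ (sphere d g) f) ≤
      16 * (C₁ + C₂) * (#(sphere d g) : ℝ) ^ (-(1 / p)) := by
  have hd5 : (5 : ℝ) ≤ d := by rw [hd]; exact_mod_cast (by omega)
  have hD : 0 < 3 * (d : ℝ) - 2 := by linarith
  have hDne : 3 * (d : ℝ) - 2 ≠ 0 := hD.ne'
  have hd0 : (d : ℝ) ≠ 0 := by linarith
  have hp0 : 0 < p := by rw [hp]; positivity
  have hp2 : p ≤ 2 := by rw [hp, div_le_iff₀ hD]; linarith
  have hpinv : 1 / p = (3 * (d : ℝ) - 2) / (4 * d) := by rw [hp, one_div_div]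
  have hpD : p * (3 * (d : ℝ) - 2) = 4 * d := by rw [hp, div_mul_cancel₀ _ hDne]
  have hθp : p * (3 / 4) - 1 = θ := by
    rw [hθ, eq_div_iff hDne]; linear_combination 3 / 4 * hpD
  have hβp : p * (1 / 2) - 1 = -β := by
    rw [hβ, ← neg_div, eq_div_iff hDne]; linear_combination 1 / 2 * hpD
  obtain ⟨n, A, hAV, hAcard, hfA⟩ := exists_dyadic_levels (sphere d g) f hp0 hf
  have hsize := card_pow_le_card_sphere hF hχ (d := d) (by omega) g
  have hind := fun i => countingNorm_extension_indicator_le hF hχ hg hd (hAV i)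
  have hcardV : ∀ i, (#(A i) : ℝ) ≤ #(sphere d g) := fun i => by
    exact_mod_cast card_le_card (hAV i)
  have hq2 : (2 : ℝ) ≤ Fintype.card F := two_le_card
  set V := sphere d g
  set q : ℝ := (Fintype.card F : ℝ)
  have hq0 : 0 < q := by linarith
  set v : ℝ := (#V : ℝ)
  have hv : q ^ ((d : ℝ) - 1) ≤ 2 * v := by
    rw [Real.rpow_sub_one hq0.ne', Real.rpow_natCast, div_le_iff₀ hq0]
    linarith
  have hv0 : 0 < v := by
    have : 0 < q ^ ((d : ℝ) - 1) := by positivity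
    linarith
  set P : ℝ := v⁻¹ * (2 * q ^ ((d : ℝ) / 4))
  have hP0 : 0 ≤ P := by positivity
  -- The first term has no competing energy bound; its decaying branch comes from `|A i| ≤ |V|`.
  set Y₁ : ℝ := v ^ (3 / 4 : ℝ) with hY₁
  set Y₂ : ℝ := q ^ (((d : ℝ) - 2) / 8) with hY₂
  have hterm : ∀ i, (1 / 2 : ℝ) ^ i *
      countingNorm 4 (extension χ V fun x => if x ∈ A i then 1 else 0) ≤
      P * (4 * (q ^ (-(1 / 4) : ℝ) * min (((2 : ℝ) ^ θ) ^ i) (Y₁ * ((2 : ℝ) ^ (-1 : ℝ)) ^ i) +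
        min (((2 : ℝ) ^ θ) ^ i) (Y₂ * ((2 : ℝ) ^ (-β)) ^ i))) := by
    intro i
    have ha0 : (0 : ℝ) ≤ #(A i) := Nat.cast_nonneg _
    have e1 := half_pow_mul_rpow_le (t := 3 / 4) ha0 (by norm_num) (by linarith) (hAcard i)
    have e2 := half_pow_mul_rpow_le (t := 1 / 2) ha0 (by norm_num) (by linarith) (hAcard i)
    rw [hθp] at e1
    rw [hβp] at e2
    have e3 : (1 / 2 : ℝ) ^ i * (#(A i) : ℝ) ^ (3 / 4 : ℝ) ≤
        4 * (Y₁ * ((2 : ℝ) ^ (-1 : ℝ)) ^ i) := by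
      have h1 : (#(A i) : ℝ) ^ (3 / 4 : ℝ) ≤ Y₁ :=
        Real.rpow_le_rpow ha0 (hcardV i) (by norm_num)
      have h2 : (1 / 2 : ℝ) ^ i = ((2 : ℝ) ^ (-1 : ℝ)) ^ i := by
        rw [Real.rpow_neg_one, one_div]
      rw [h2]
      calc ((2 : ℝ) ^ (-1 : ℝ)) ^ i * (#(A i) : ℝ) ^ (3 / 4 : ℝ) ≤
            ((2 : ℝ) ^ (-1 : ℝ)) ^ i * Y₁ := by gcongr
        _ = Y₁ * ((2 : ℝ) ^ (-1 : ℝ)) ^ i := mul_comm _ _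
        _ ≤ _ := le_mul_of_one_le_left (by positivity) (by norm_num)
    refine (mul_le_mul_of_nonneg_left (hind i) (by positivity)).trans ?_
    set a : ℝ := (#(A i) : ℝ)
    have e4 : (1 / 2 : ℝ) ^ i * a ^ (3 / 4 : ℝ) ≤
        4 * min (((2 : ℝ) ^ θ) ^ i) (Y₁ * ((2 : ℝ) ^ (-1 : ℝ)) ^ i) := by
      rw [mul_min_of_nonneg _ _ (by norm_num)]
      exact le_min e1 e3
    have e5 : (1 / 2 : ℝ) ^ i * min (a ^ (3 / 4 : ℝ)) (Y₂ * a ^ (1 / 2 : ℝ)) ≤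
        4 * min (((2 : ℝ) ^ θ) ^ i) (Y₂ * ((2 : ℝ) ^ (-β)) ^ i) := by
      rw [mul_min_of_nonneg _ _ (by norm_num), mul_min_of_nonneg _ _ (by positivity)]
      refine min_le_min e1 ?_
      calc (1 / 2 : ℝ) ^ i * (Y₂ * a ^ (1 / 2 : ℝ)) = Y₂ * ((1 / 2 : ℝ) ^ i * a ^ (1 / 2 : ℝ)) := by
            ring
        _ ≤ Y₂ * (4 * ((2 : ℝ) ^ (-β)) ^ i) := by gcongr
        _ = _ := by ring
    calc (1 / 2 : ℝ) ^ i * (P * (q ^ (-(1 / 4) : ℝ) * a ^ (3 / 4 : ℝ) +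
          min (a ^ (3 / 4 : ℝ)) (Y₂ * a ^ (1 / 2 : ℝ)))) =
        P * (q ^ (-(1 / 4) : ℝ) * ((1 / 2 : ℝ) ^ i * a ^ (3 / 4 : ℝ)) +
          (1 / 2 : ℝ) ^ i * min (a ^ (3 / 4 : ℝ)) (Y₂ * a ^ (1 / 2 : ℝ))) := by ring
      _ ≤ P * (q ^ (-(1 / 4) : ℝ) *
            (4 * min (((2 : ℝ) ^ θ) ^ i) (Y₁ * ((2 : ℝ) ^ (-1 : ℝ)) ^ i)) +
          4 * min (((2 : ℝ) ^ θ) ^ i) (Y₂ * ((2 : ℝ) ^ (-β)) ^ i)) := by gcongr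
      _ = _ := by ring
  have hsum : countingNorm 4 (extension χ V f) ≤ P * (4 * (q ^ (-(1 / 4) : ℝ) *
      (C₁ * Y₁ ^ (θ / (θ + 1))) + C₂ * Y₂ ^ (θ / (θ + β)))) := by
    refine (countingNorm_extension_mono hχ hfA).trans ?_
    have e := countingNorm_extension_sum_le (χ := χ) V (range n) (fun i => (1 / 2 : ℝ) ^ i)
      (fun i => by positivity) (fun i x => if x ∈ A i then 1 else 0)
    refine le_trans (le_of_eq ?_) (e.trans ((sum_le_sum fun i _ => hterm i).trans ?_))
    · congr 2
      ext x
      push_cast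
      refine sum_congr rfl fun i _ => ?_
      split_ifs <;> simp
    · rw [← mul_sum, ← mul_sum, sum_add_distrib, ← mul_sum]
      gcongr
      · exact hC₁ _ (by positivity) n
      · exact hC₂ _ (by positivity) n
  refine hsum.trans ?_
  -- Trades powers of `q` for powers of `|V|`, using that the sphere has at least `q^(d-1)/2`
  -- points.
  have hpow : ∀ t : ℝ, 0 ≤ t → t ≤ 1 → q ^ (((d : ℝ) - 1) * t) ≤ 2 * v ^ t := by
    intro t h0 h1
    rw [Real.rpow_mul hq0.le]
    refine (Real.rpow_le_rpow (by positivity) hv h0).trans ?_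
    rw [Real.mul_rpow (by norm_num) hv0.le]
    gcongr
    calc (2 : ℝ) ^ t ≤ 2 ^ (1 : ℝ) := Real.rpow_le_rpow_of_exponent_le (by norm_num) h1
      _ = 2 := Real.rpow_one 2
  have t1 : v⁻¹ * q ^ ((d : ℝ) / 4) * (q ^ (-(1 / 4) : ℝ) * Y₁ ^ (θ / (θ + 1))) ≤
      2 * v ^ (-(1 / p)) := by
    have e1 : q ^ ((d : ℝ) / 4) * q ^ (-(1 / 4) : ℝ) = q ^ (((d : ℝ) - 1) * (1 / 4)) := by
      rw [← Real.rpow_add hq0]; congr 1; ring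
    have e2 : v ^ (1 / 4 : ℝ) * v⁻¹ * Y₁ ^ (θ / (θ + 1)) = v ^ (-(1 / p)) := by
      rw [hY₁, ← Real.rpow_neg_one, ← Real.rpow_mul hv0.le, ← Real.rpow_add hv0,
        ← Real.rpow_add hv0]
      congr 1
      rw [hpinv, hθ]
      have : 2 / (3 * (d : ℝ) - 2) + 1 ≠ 0 := by positivity
      field_simp
      ring
    calc _ = q ^ ((d : ℝ) / 4) * q ^ (-(1 / 4) : ℝ) * (v⁻¹ * Y₁ ^ (θ / (θ + 1))) := by ring
      _ ≤ 2 * v ^ (1 / 4 : ℝ) * (v⁻¹ * Y₁ ^ (θ / (θ + 1))) := by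
          rw [e1]
          gcongr
          exact hpow _ (by norm_num) (by norm_num)
      _ = 2 * (v ^ (1 / 4 : ℝ) * v⁻¹ * Y₁ ^ (θ / (θ + 1))) := by ring
      _ = _ := by rw [e2]
  have t2 : v⁻¹ * q ^ ((d : ℝ) / 4) * Y₂ ^ (θ / (θ + β)) ≤ 2 * v ^ (-(1 / p)) := by
    have e1 : q ^ ((d : ℝ) / 4) * Y₂ ^ (θ / (θ + β)) =
        q ^ (((d : ℝ) - 1) * (((d : ℝ) + 2) / (4 * d))) := by
      rw [hY₂, ← Real.rpow_mul hq0.le, ← Real.rpow_add hq0]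
      congr 1
      have e : θ / (θ + β) = 2 / d := by
        rw [hθ, hβ, ← add_div, div_div_div_cancel_right₀ hD.ne']
        congr 1
        ring
      rw [e]
      field_simp
      ring
    have e2 : v⁻¹ * v ^ (((d : ℝ) + 2) / (4 * d)) = v ^ (-(1 / p)) := by
      rw [← Real.rpow_neg_one, ← Real.rpow_add hv0]
      congr 1
      rw [hpinv]
      field_simp
      ring
    calc _ = v⁻¹ * (q ^ ((d : ℝ) / 4) * Y₂ ^ (θ / (θ + β))) := by ring
      _ ≤ v⁻¹ * (2 * v ^ (((d : ℝ) + 2) / (4 * d))) := by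
          rw [e1]
          gcongr
          refine hpow _ (by positivity) ?_
          rw [div_le_one (by positivity)]
          linarith
      _ = 2 * (v⁻¹ * v ^ (((d : ℝ) + 2) / (4 * d))) := by ring
      _ = _ := by rw [e2]
  calc _ = 8 * C₁ * (v⁻¹ * q ^ ((d : ℝ) / 4) * (q ^ (-(1 / 4) : ℝ) * Y₁ ^ (θ / (θ + 1)))) +
        8 * C₂ * (v⁻¹ * q ^ ((d : ℝ) / 4) * Y₂ ^ (θ / (θ + β))) := by ring
    _ ≤ 8 * C₁ * (2 * v ^ (-(1 / p))) + 8 * C₂ * (2 * v ^ (-(1 / p))) := by gcongr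
    _ = _ := by ring

/-- An extension estimate for normalized functions extends to all functions by homogeneity. -/
theorem extensionConst_le {V : Finset (Fin d → F)} {p C : ℝ} (hp : 0 < p)
    (hC : 0 ≤ C) (h : ∀ f : (Fin d → F) → ℂ, ∑ x ∈ V, ‖f x‖ ^ p ≤ 1 →
      countingNorm 4 (extension χ V f) ≤ C * (#V : ℝ) ^ (-(1 / p))) :
    extensionConst χ V p 4 ≤ C := by
  refine csInf_le ⟨0, fun _ h => h.1⟩ ⟨hC, fun f => ?_⟩
  set T := ∑ x ∈ V, ‖f x‖ ^ p with hT
  have hT0 : 0 ≤ T := by positivity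
  have hscale : ∀ {s : ℝ}, 0 ≤ s → ∀ f' : (Fin d → F) → ℂ, (∀ x ∈ V, f x = s * f' x) →
      countingNorm 4 (extension χ V f) ≤ s * countingNorm 4 (extension χ V f') := by
    intro s hs f' hf'
    have := countingNorm_extension_sum_le (χ := χ) V (range 1) (fun _ => s) (fun _ => hs)
      (fun _ => f')
    simp only [range_one, sum_singleton] at this
    refine le_trans (le_of_eq ?_) this
    congr 1
    ext m
    simp only [extension]
    congr 1
    exact sum_congr rfl fun x hx => by rw [hf' x hx]
  have hsurf : surfaceNorm V p f = (#V : ℝ) ^ (-(1 / p)) * T ^ (1 / p) := by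
    rw [surfaceNorm, Real.mul_rpow (by positivity) hT0, Real.inv_rpow (by positivity),
      Real.rpow_neg (by positivity)]
  rcases hT0.eq_or_lt with h0 | h0
  · have hz : ∀ x ∈ V, f x = (0 : ℝ) * f x := by
      intro x hx
      have := (sum_eq_zero_iff_of_nonneg fun x _ => by positivity).1 h0.symm x hx
      rw [Real.rpow_eq_zero (norm_nonneg _) hp.ne', norm_eq_zero] at this
      simp [this]
    refine (hscale le_rfl f hz).trans ?_
    rw [zero_mul, hsurf]
    positivity
  · set M := T ^ (1 / p) with hM
    have hM0 : 0 < M := by positivity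
    have hMp : M ^ p = T := by
      rw [hM, ← Real.rpow_mul hT0, one_div_mul_cancel hp.ne', Real.rpow_one]
    refine (hscale hM0.le (fun x => (M : ℂ)⁻¹ * f x) fun x _ => ?_).trans ?_
    · rw [mul_inv_cancel_left₀]
      exact_mod_cast hM0.ne'
    · rw [hsurf]
      calc M * countingNorm 4 (extension χ V fun x => (M : ℂ)⁻¹ * f x) ≤
            M * (C * (#V : ℝ) ^ (-(1 / p))) := by
            gcongr
            refine h _ (le_of_eq ?_)
            have : ∀ x ∈ V, ‖(M : ℂ)⁻¹ * f x‖ ^ p = T⁻¹ * ‖f x‖ ^ p := by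
              intro x _
              rw [norm_mul, norm_inv, Complex.norm_real, Real.norm_of_nonneg hM0.le,
                Real.mul_rpow (by positivity) (by positivity), Real.inv_rpow hM0.le, hMp]
            rw [sum_congr rfl this, ← mul_sum, ← hT, inv_mul_cancel₀ h0.ne']
        _ = _ := by ring

theorem ringChar_ne_two_of_odd_card (h : Odd (Fintype.card F)) : ringChar F ≠ 2 := by
  intro h2
  rw [← Nat.not_even_iff_odd] at h
  exact h (Nat.even_iff.2 (FiniteField.even_card_of_char_two h2))

end Restriction

end FFExtension

theorem theorem1p8 (k d : ℕ) (hk : 1 ≤ k) (hd : d = 4 * k + 1) :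
    (∃ C : ℝ, 0 < C ∧
      ∀ (F : Type*) [Field F] [Fintype F] [DecidableEq F], Odd (Fintype.card F) →
        ∀ χ : AddChar F ℂ, χ ≠ 1 →
          ∀ g : F, FFExtension.IsPrimitiveElement g →
            FFExtension.extensionConst χ (FFExtension.sphere d g)
              (4 * (d : ℝ) / (3 * (d : ℝ) - 2)) 4 ≤ C) ∧
    4 * (d : ℝ) / (3 * (d : ℝ) - 2) < (4 * (d : ℝ) - 4) / (3 * (d : ℝ) - 5) := by
  have hd5 : (5 : ℝ) ≤ d := by rw [hd]; exact_mod_cast (by omega)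
  have hD : 0 < 3 * (d : ℝ) - 2 := by linarith
  constructor
  · have hθ0 : 0 < 2 / (3 * (d : ℝ) - 2) := by positivity
    have hβ0 : 0 < ((d : ℝ) - 2) / (3 * (d : ℝ) - 2) := div_pos (by linarith) hD
    -- Both constants are fixed before the field appears, so they depend only on `d`.
    obtain ⟨C₁, hC₁0, hC₁⟩ := FFExtension.exists_sum_min_le hθ0 one_pos
    obtain ⟨C₂, hC₂0, hC₂⟩ := FFExtension.exists_sum_min_le hθ0 hβ0
    refine ⟨16 * (C₁ + C₂), by positivity, ?_⟩
    intro F _ _ _ hodd χ hχ g hg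
    have hF := FFExtension.ringChar_ne_two_of_odd_card hodd
    exact FFExtension.extensionConst_le (by positivity) (by positivity) fun f hf =>
      FFExtension.countingNorm_extension_le_of_sum_le_one hF hχ
        (hg.quadraticChar_eq_neg_one hF) hk hd rfl rfl rfl hC₁0 hC₂0 hC₁ hC₂ f hf
  -- After cross-multiplication the two sides differ by exactly `8`.
  · rw [div_lt_div_iff₀ hD (by linarith)]
    nlinarith
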